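/- **Theorem 3.1.** For a prime $\pi$ of $\mathbb Z[i]$ of odd norm $N\pi$ and $\alpha\in\mathbb Z[i]$, let $\left(\frac{\alpha}{\pi}\right)_4=0$ if $\pi\mid\alpha$, and otherwise let $\left(\frac{\alpha}{\pi}\right)_4\in\{1,i,-1,-i\}$ be determined by $\alpha^{(N\pi-1)/4}\equiv\left(\frac{\alpha}{\pi}\right)_4\pmod{\pi}$. For an odd integer $m$ let $\left(\frac{\alpha}{m}\right)_4=\prod_\pi\left(\frac{\alpha}{\pi}\right)_4$, where $\pi$ runs, with multiplicity, over the prime factors of $m$ in $\mathbb Z[i]$ (so the symbol is $1$ if $m=\pm1$). For a fraction $\frac ab$ with $b$ prime to $m$, let $\left(\frac{a/b+i}{m}\right)_4=\left(\frac{t+i}{m}\right)_4$, where $t$ is any integer with $tb\equiv a\pmod m$; this $t$ is used even if $b=0$, which is possible only for $m=\pm1$. Let $p\equiv 1\pmod 4$ be a prime, and let $q$ be an odd integer (of either sign) with $p\nmid q$. Suppose that $p=c^2+d^2=x^2+qy^2$ with $c,d,x,y\in\mathbb Z$, $c\equiv 1\pmod 4$, $d=2^rd_0$ with $r\ge 0$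 and $d_0\equiv 1\pmod 4$, $(c,x+d)=1$, $2\mid x$ and $y\equiv 1\pmod 4$. Then $q\equiv 1\pmod 4$, $x+d$ is prime to $q$, and $\left(\frac{c/(x+d)+i}{q}\right)_4$ is a power of $i$. Let $k$ be any integer with $$\left(\frac{c/(x+d)+i}{q}\right)_4=i^k .$$ (i) If $p\equiv 1\pmod 8$, then $$q^{\frac{p-1}8}\equiv\begin{cases}(-1)^{\frac{q-1}8+\frac d4+\frac x4}\left(\frac dc\right)^k\pmod p&\text{if } q\equiv 1\pmod 8,\\[2pt](-1)^{\frac{q-5}8+\frac d4+\frac{x-2}4}\left(\frac dc\right)^{k+1}\pmod p&\text{if } q\equiv 5\pmod 8.\end{cases}$$ (ii) If $p\equiv 5\pmod 8$, then $$q^{\frac{p-5}8}\equiv\begin{cases}(-1)^{\frac{q-1}8+\frac{x-2}4}\left(\frac dc\right)^{k+1}\frac yx\pmod p&\text{if } q\equiv 1\pmod 8,\\[2pt](-1)^{\frac{q-5}8+\frac x4}\left(\frac dc\right)^{k}\frac yx\pmod p&\text{if } q\equiv 5\pmod 8.\end{cases}$$ Here the exponents of $-1$ are integers, $c$ and $x$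 are prime to $p$, and $\frac dc$ and $\frac yx$ are taken modulo $p$. -/

import Mathlib

noncomputable section

open scoped Classical in
/-- The quartic residue symbol `(α/π)₄` for a prime `π` of `ℤ[i]` of odd norm: it is `0` if
`π ∣ α`, and otherwise the unique power `i ^ r` with `α ^ ((N π - 1) / 4) ≡ i ^ r (mod π)`.
(If `π ∣ α`, then none of the four congruences holds.)  It depends on `π` only up to units, so
that no primary generator has to be chosen. -/
def quarticResidueSymbol (α π : GaussianInt) : ℂ :=
  if π ∣ α ^ ((π.norm.natAbs - 1) / 4) - 1 then 1
  else if π ∣ α ^ ((π.norm.natAbs - 1) / 4) - (⟨0, 1⟩ : GaussianInt) then Complex.I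
  else if π ∣ α ^ ((π.norm.natAbs - 1) / 4) + 1 then -1
  else if π ∣ α ^ ((π.norm.natAbs - 1) / 4) + (⟨0, 1⟩ : GaussianInt) then -Complex.I
  else 0

/-- The quartic Jacobi symbol `(α/β)₄` for `β ∈ ℤ[i]` of odd norm: the product of the quartic
residue symbols `(α/π)₄` over the prime factors `π` of `β`, with multiplicity.  It is `1` if `β`
is a unit. -/
def quarticJacobiSymbol (α β : GaussianInt) : ℂ :=
  ((UniqueFactorizationMonoid.factors β).map fun π => quarticResidueSymbol α π).prod

/-- The residue of the rational number `r` modulo `n`, as an integer `t` with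
`t * r.den ≡ r.num (mod n)`; here the denominator of `r` has to be prime to `n`. -/
def ratResidue (r : ℚ) (n : ℤ) : ℤ :=
  ((r.num : ZMod n.natAbs) * (r.den : ZMod n.natAbs)⁻¹).cast

/-- The symbol `((r + i)/m)₄` for an odd integer `m` and a rational number `r` whose denominator
is prime to `m`; the number `r` stands for its residue modulo `m`. -/
def quarticSymbolRatAddI (r : ℚ) (m : ℤ) : ℂ :=
  quarticJacobiSymbol ⟨ratResidue r m, 1⟩ (m : GaussianInt)

end

/-! Put π = c + di, of norm p, and ρ = c + (x+d)i. In the residue field of π one has i = d/c, so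
(n/π)₄ becomes n^((p-1)/4) for rational n, and powers of i become powers of d/c. As q ≡ -(x/y)² (mod
p), q^N is (-1)^N (x/y)^(2N). Here 2N is (p-1)/4, or one less if p ≡ 5 (mod 8), so everything
reduces to comparing (x/π)₄ with (y/π)₄.

The comparison passes through ρ (`quarticJacobi_x_eq`). Since Nρ = 2x(x+d) + qy², one has -2x(x+d) ≡
qy² (mod ρ), and symbols at ρ are taken on both sides. Those of -1 and 2 come from supplementary
laws and that of x+d from `quarticJacobi_im`. By reciprocity (q/ρ)₄ = (ρ/q)₄, which is the symbol of
c/(x+d) + i because the rational factor x+d has symbol 1 at q. From ρ² ≡ 2(x+d)iπ (mod y) follows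
(y/ρ)₄² = (i/y)₄(y/π)₄. Finally ρ ≡ π (mod x) gives (x/ρ)₄ = (x/π)₄ up to a power of i
(`quarticJacobi_shift`). The exponents of i are collected in `exponent_modEq`.

The reciprocity law needed, `quarticJacobi_intCast_comm`, has one rational argument ≡ 1 (mod 4). For
a prime π with even imaginary part the quartic character has Jacobi sum ±π (`quarticJacobiSum_eq`),
so its Gauss sum has fourth power π³π̄. Raising the Gauss sum to the l-th power in characteristic l
relates the symbol of l at π to that of π at l. The law for 2 comes from quadratic reciprocity via
(a+b)² ≡ 2ia² (mod a+bi). -/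

namespace GaussianInt

/-! ### Units and quartic values in ℤ[i] -/

/-- The imaginary unit of `ℤ[i]`. -/
def imUnit : GaussianInt := ⟨0, 1⟩

@[simp] lemma imUnit_re : imUnit.re = 0 := rfl
@[simp] lemma imUnit_im : imUnit.im = 1 := rfl

lemma imUnit_sq : imUnit ^ 2 = -1 := by decide

lemma imUnit_mul_self : imUnit * imUnit = -1 := by decide

lemma imUnit_pow_four : imUnit ^ 4 = 1 := by decide

lemma isUnit_imUnit : IsUnit imUnit := IsUnit.of_mul_eq_one (-imUnit) (by decide)

lemma norm_eq (α : GaussianInt) : α.norm = α.re ^ 2 + α.im ^ 2 := by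
  rw [Zsqrtd.norm_def]; ring

lemma pow_four_eq_one_cases {u : GaussianInt} (h : u ^ 4 = 1) :
    u = 1 ∨ u = imUnit ∨ u = -1 ∨ u = -imUnit := by
  have : (u - 1) * ((u - imUnit) * ((u + 1) * (u + imUnit))) = 0 := by
    linear_combination h + (1 - u ^ 2) * imUnit_sq
  simpa only [mul_eq_zero, sub_eq_zero, add_eq_zero_iff_eq_neg] using this

lemma pow_four_of_isUnit {u : GaussianInt} (hu : IsUnit u) : u ^ 4 = 1 := by
  have h : u.re ^ 2 + u.im ^ 2 = 1 := by
    rw [← norm_eq]; exact (Zsqrtd.norm_eq_one_iff' (by norm_num) u).mpr hu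
  have h1 : -1 ≤ u.re := by nlinarith [sq_nonneg u.im]
  have h2 : u.re ≤ 1 := by nlinarith [sq_nonneg u.im]
  have h3 : -1 ≤ u.im := by nlinarith [sq_nonneg u.re]
  have h4 : u.im ≤ 1 := by nlinarith [sq_nonneg u.re]
  obtain ⟨a, b⟩ := u
  simp only at h h1 h2 h3 h4
  interval_cases a <;> interval_cases b <;> first | decide | (exfalso; revert h; decide)

lemma isUnit_of_pow_four {u : GaussianInt} (hu : u ^ 4 = 1) : IsUnit u :=
  IsUnit.of_pow_eq_one hu (by norm_num)

lemma mul_star_of_pow_four {u : GaussianInt} (h : u ^ 4 = 1) : u * star u = 1 := by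
  rw [← Zsqrtd.norm_eq_mul_conj,
    (Zsqrtd.norm_eq_one_iff' (by norm_num) u).mpr (isUnit_of_pow_four h)]
  rfl

lemma eq_imUnit_pow {u : GaussianInt} (h : u ^ 4 = 1) : ∃ k : ℕ, u = imUnit ^ k := by
  rcases pow_four_eq_one_cases h with h | h | h | h
  · exact ⟨0, h⟩
  · exact ⟨1, by rw [h, pow_one]⟩
  · exact ⟨2, by rw [h]; decide⟩
  · exact ⟨3, by rw [h]; decide⟩

/-- Values of quartic residue symbols: `0` or a fourth root of unity. -/
def IsQuarticValue (u : GaussianInt) : Prop := u = 0 ∨ u ^ 4 = 1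

lemma IsQuarticValue.mul {u v : GaussianInt} (hu : IsQuarticValue u) (hv : IsQuarticValue v) :
    IsQuarticValue (u * v) := by
  rcases hu with rfl | hu
  · left; simp
  rcases hv with rfl | hv
  · left; simp
  · right; rw [mul_pow, hu, hv, one_mul]

/-- Distinct values among 0, ±1, ±i differ by an element of norm 1, 2 or 4. Hence no nonunit of odd
norm can identify two of them. -/
lemma IsQuarticValue.norm_sub_dvd {u v : GaussianInt} (hu : IsQuarticValue u)
    (hv : IsQuarticValue v) (h : u ≠ v) : (u - v).norm ∣ 4 := by
  have key : ∀ w, IsQuarticValue w →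
      w = 0 ∨ w = 1 ∨ w = imUnit ∨ w = -1 ∨ w = -imUnit := by
    rintro w (h | h)
    · exact Or.inl h
    · exact Or.inr (pow_four_eq_one_cases h)
  rcases key u hu with rfl | rfl | rfl | rfl | rfl <;>
  rcases key v hv with rfl | rfl | rfl | rfl | rfl <;>
  first | exact absurd rfl h | decide

lemma norm_dvd_norm {α β : GaussianInt} (h : α ∣ β) : α.norm ∣ β.norm := by
  obtain ⟨γ, rfl⟩ := h
  rw [Zsqrtd.norm_mul]; exact dvd_mul_right _ _

lemma odd_norm_of_dvd {α β : GaussianInt} (h : α ∣ β) (hβ : Odd β.norm) : Odd α.norm :=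
  (Int.odd_mul.mp ((norm_dvd_norm h).choose_spec ▸ hβ)).1

lemma norm_eq_one_of_dvd_four {n : ℤ} (hn : Odd n) (h0 : 0 ≤ n) (h : n ∣ 4) : n = 1 := by
  have h4 : n ≤ 4 := Int.le_of_dvd (by norm_num) h
  interval_cases n <;> first | rfl | (exfalso; revert hn h; decide)

/-- Quartic values are determined by their residue modulo a nonunit of odd norm. -/
lemma IsQuarticValue.eq_of_dvd_sub {π u v : GaussianInt} (hπ : Odd π.norm) (hπ' : ¬ IsUnit π)
    (hu : IsQuarticValue u) (hv : IsQuarticValue v) (h : π ∣ u - v) : u = v := by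
  by_contra hne
  refine hπ' ((Zsqrtd.norm_eq_one_iff' (by norm_num) π).mp ?_)
  exact norm_eq_one_of_dvd_four hπ (GaussianInt.norm_nonneg π)
    ((norm_dvd_norm h).trans (hu.norm_sub_dvd hv hne))

lemma ne_zero_of_odd_norm {α : GaussianInt} (h : Odd α.norm) : α ≠ 0 := by
  rintro rfl
  simp at h

lemma norm_mod_four {α : GaussianInt} (h : Odd α.norm) : α.norm % 4 = 1 := by
  rw [norm_eq] at h ⊢
  rcases Int.even_or_odd' α.re with ⟨a, ha | ha⟩ <;>
  rcases Int.even_or_odd' α.im with ⟨b, hb | hb⟩ <;> rw [ha, hb] at h ⊢ <;> ring_nf at h ⊢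
  · exfalso; rw [Int.odd_iff] at h; omega
  · omega
  · omega
  · exfalso; rw [Int.odd_iff] at h; omega

lemma odd_iff_of_odd_norm {α : GaussianInt} (h : Odd α.norm) : Odd α.re ↔ Even α.im := by
  rw [norm_eq] at h
  rw [← Int.not_even_iff_odd, Int.even_add, Int.even_pow' two_ne_zero,
    Int.even_pow' two_ne_zero] at h
  rw [← Int.not_even_iff_odd]
  tauto

/-! ### Primes of odd norm and their residue fields -/

/-- A prime of `ℤ[i]` of odd norm either has prime norm `p ≡ 1 (mod 4)` or is associated to a
rational prime `p ≡ 3 (mod 4)`. -/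
lemma prime_cases {π : GaussianInt} (hπ : Prime π) (hodd : Odd π.norm) :
    (∃ p : ℕ, p.Prime ∧ p % 4 = 1 ∧ π.norm = p) ∨
      ∃ p : ℕ, p.Prime ∧ p % 4 = 3 ∧ Associated π (p : GaussianInt) := by
  have hdvd : π ∣ ((π.norm.natAbs : ℕ) : GaussianInt) := by
    have h1 : ((π.norm.natAbs : ℕ) : GaussianInt) = ((π.norm : ℤ) : GaussianInt) := by
      rw [← Int.cast_natCast, GaussianInt.abs_natCast_norm]
    rw [h1, Zsqrtd.norm_eq_mul_conj]
    exact dvd_mul_right _ _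
  have hn0 : π.norm.natAbs ≠ 0 := by
    rw [Int.natAbs_ne_zero]; exact (GaussianInt.norm_pos.mpr hπ.ne_zero).ne'
  obtain ⟨p, hp, hpπ⟩ : ∃ p : ℕ, p.Prime ∧ π ∣ (p : GaussianInt) := by
    have : ∀ n : ℕ, n ≠ 0 → π ∣ (n : GaussianInt) → ∃ p : ℕ, p.Prime ∧ π ∣ (p : GaussianInt) := by
      intro n
      induction n using Nat.recOnMul with
      | zero => intro h; exact absurd rfl h
      | one => intro _ h; exact absurd (isUnit_of_dvd_one (by simpa using h)) hπ.not_isUnit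
      | prime p hp => intro _ h; exact ⟨p, hp, h⟩
      | mul a b iha ihb =>
        intro h0 h
        push_cast at h
        rcases hπ.dvd_or_dvd h with h | h
        · exact iha (left_ne_zero_of_mul h0) h
        · exact ihb (right_ne_zero_of_mul h0) h
    exact this _ hn0 hdvd
  obtain ⟨κ, hκ⟩ := hpπ
  have hnorm : ((p : ℤ)) * p = π.norm * κ.norm := by
    rw [← Zsqrtd.norm_mul, ← hκ, Zsqrtd.norm_natCast]
  have hnorm' : π.norm.natAbs * κ.norm.natAbs = p ^ 2 := by
    rw [← Int.natAbs_mul, ← hnorm, Int.natAbs_mul, Int.natAbs_natCast, sq]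
  have hπ1 : π.norm.natAbs ≠ 1 := by
    rw [Ne, Zsqrtd.norm_eq_one_iff]; exact hπ.not_isUnit
  obtain ⟨j, hj, hj'⟩ := (Nat.dvd_prime_pow hp).mp (Dvd.intro _ hnorm')
  have hcast : π.norm = (p ^ j : ℕ) := by rw [← hj', GaussianInt.abs_natCast_norm]
  have h41 := norm_mod_four hodd
  interval_cases j
  · exact absurd hj' (by simpa using hπ1)
  · left
    rw [pow_one] at hcast
    exact ⟨p, hp, by omega, hcast⟩
  · right
    have hκ1 : κ.norm.natAbs = 1 := by
      have := hp.pos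
      rw [hj'] at hnorm'
      exact Nat.eq_of_mul_eq_mul_left (by positivity : 0 < p ^ 2) (by rw [hnorm', mul_one])
    have hass : Associated π (p : GaussianInt) := by
      rw [hκ]
      exact (associated_mul_unit_right _ _ (Zsqrtd.norm_eq_one_iff.mp hκ1))
    have : Fact p.Prime := ⟨hp⟩
    exact ⟨p, hp, GaussianInt.mod_four_eq_three_of_nat_prime_of_prime p
      (hass.prime_iff.mp hπ), hass⟩

lemma prime_of_norm_eq_prime {π : GaussianInt} {p : ℕ} (hp : p.Prime) (h : π.norm = p) :
    Prime π := by
  rw [← irreducible_iff_prime, irreducible_iff]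
  refine ⟨fun hu => ?_, fun a b hab => ?_⟩
  · have h1 := (Zsqrtd.norm_eq_one_iff' (by norm_num) π).mpr hu
    rw [h] at h1
    exact hp.one_lt.ne' (by exact_mod_cast h1)
  · rw [← Zsqrtd.norm_eq_one_iff, ← Zsqrtd.norm_eq_one_iff]
    have : a.norm.natAbs * b.norm.natAbs = p := by
      rw [← Int.natAbs_mul, ← Zsqrtd.norm_mul, ← hab, h, Int.natAbs_natCast]
    rcases Nat.prime_mul_iff.mp (this ▸ hp) with h | h
    · exact Or.inr h.2
    · exact Or.inl h.2

lemma eq_re_add_im (α : GaussianInt) : α = (α.re : GaussianInt) + α.im * imUnit := by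
  ext <;> simp

/-- The residue field map at a prime of prime norm. -/
lemma exists_ringHom_zmod {π : GaussianInt} {p : ℕ} [Fact p.Prime] (h : π.norm = p) :
    ∃ φ : GaussianInt →+* ZMod p, ∀ α, φ α = 0 ↔ π ∣ α := by
  have hp : p.Prime := Fact.out
  have hN : (π.re : ZMod p) ^ 2 + (π.im : ZMod p) ^ 2 = 0 := by
    have : ((π.re ^ 2 + π.im ^ 2 : ℤ) : ZMod p) = 0 := by rw [← norm_eq, h]; simp
    exact_mod_cast this
  have hre : (π.re : ZMod p) ≠ 0 := by
    intro h0
    have h1 : (π.im : ZMod p) = 0 := by simpa [h0] using hN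
    rw [ZMod.intCast_zmod_eq_zero_iff_dvd] at h0 h1
    have h2 : (p : ℤ) * p ∣ p := by
      have e : (p : ℤ) = π.re * π.re + π.im * π.im := by rw [← h, norm_eq, sq, sq]
      conv_rhs => rw [e]
      exact dvd_add (mul_dvd_mul h0 h0) (mul_dvd_mul h1 h1)
    have h3 := Int.le_of_dvd (by exact_mod_cast hp.pos) h2
    have h4 : (1 : ℤ) < p := by exact_mod_cast hp.one_lt
    nlinarith
  have hsq : ((π.im : ZMod p) / π.re) * (π.im / π.re) = ((-1 : ℤ) : ZMod p) := by
    field_simp; push_cast; linear_combination hN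
  -- The relation re + im·i = 0 forced in the residue field gives i = im/re, because i² = -1.
  let φ : GaussianInt →+* ZMod p := Zsqrtd.lift ⟨(π.im : ZMod p) / π.re, hsq⟩
  have hφ : ∀ α : GaussianInt, φ α = α.re + α.im * ((π.im : ZMod p) / π.re) := fun α => rfl
  have hφπ : φ π = 0 := by
    rw [hφ]; field_simp; rw [hN, mul_zero]
  refine ⟨φ, fun α => ⟨fun h0 => ?_, fun ⟨β, hβ⟩ => by rw [hβ, map_mul, hφπ, zero_mul]⟩⟩
  have hprime := prime_of_norm_eq_prime hp h
  rw [hφ] at h0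
  have h1 : ((α.re * π.re + α.im * π.im : ℤ) : ZMod p) = 0 := by
    push_cast
    have : (α.re : ZMod p) = - (α.im * ((π.im : ZMod p) / π.re)) := by linear_combination h0
    rw [this]; field_simp; ring
  rw [ZMod.intCast_zmod_eq_zero_iff_dvd] at h1
  obtain ⟨m, hm⟩ := h1
  have hp' : (p : GaussianInt) = π * star π := by
    rw [← Zsqrtd.norm_eq_mul_conj, h]; simp
  -- α·re π equals Re(α π̄) + (im α)·i·π, and p divides Re(α π̄) by `hm`.
  have h2 : π ∣ α * (π.re : GaussianInt) := by
    refine ⟨star π * m + α.im * imUnit, ?_⟩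
    have h3 : ((α.re * π.re + α.im * π.im : ℤ) : GaussianInt) = π * star π * m := by
      rw [hm, ← hp']; push_cast; ring
    rw [mul_add, ← mul_assoc, ← h3]
    push_cast
    conv_lhs => rw [eq_re_add_im α]
    conv_rhs => rw [eq_re_add_im π]
    simp only [Zsqrtd.re_add, Zsqrtd.im_add, Zsqrtd.re_mul, Zsqrtd.im_mul, Zsqrtd.re_intCast,
      Zsqrtd.im_intCast, imUnit_re, imUnit_im]
    push_cast
    linear_combination (-(α.im : GaussianInt) * π.im) * imUnit_sq
  refine (hprime.dvd_or_dvd h2).resolve_right fun h3 => hre ?_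
  have : φ (π.re : GaussianInt) = 0 := by
    obtain ⟨β, hβ⟩ := h3
    rw [hβ, map_mul, hφπ, zero_mul]
  simpa using this

/-- The Frobenius modulo a rational prime `p ≡ 3 (mod 4)` is conjugation. -/
lemma natCast_dvd_pow_sub_star {p : ℕ} (hp : p.Prime) (h3 : p % 4 = 3) (β : GaussianInt) :
    (p : GaussianInt) ∣ β ^ p - star β := by
  have : Fact p.Prime := ⟨hp⟩
  have hI : imUnit ^ p = -imUnit := by
    rw [← Nat.div_add_mod p 4, h3, pow_add, pow_mul, imUnit_pow_four, one_pow]; decide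
  have hz : ∀ n : ℤ, (p : GaussianInt) ∣ (n : GaussianInt) ^ p - n := by
    intro n
    have : (p : ℤ) ∣ n ^ p - n := by
      rw [← ZMod.intCast_zmod_eq_zero_iff_dvd]
      push_cast; rw [ZMod.pow_card, sub_self]
    obtain ⟨m, hm⟩ := this
    exact ⟨m, by exact_mod_cast congrArg (Int.cast : ℤ → GaussianInt) hm⟩
  have hst : star β = β.re - β.im * imUnit := by ext <;> simp
  obtain ⟨γ, hγ⟩ := exists_add_pow_prime_eq hp (β.re : GaussianInt) (β.im * imUnit)
  rw [hst]
  conv_rhs => rw [eq_re_add_im β]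
  rw [hγ, mul_pow, hI]
  have e : ∀ a b c d g : GaussianInt, a ^ p + b ^ p * -c + p * d * g * γ - (a - b * c) =
    (a ^ p - a) - c * (b ^ p - b) + p * (d * g * γ) := by intros; ring
  simp only [Zsqrtd.re_add, Zsqrtd.im_add, Zsqrtd.re_mul, Zsqrtd.im_mul, Zsqrtd.re_intCast,
    Zsqrtd.im_intCast, imUnit_re, imUnit_im, mul_zero, add_zero, mul_one, zero_add]
  rw [e]
  exact dvd_add (dvd_sub (hz _) (Dvd.dvd.mul_left (hz _) _)) (dvd_mul_right _ _)

/-- Fermat's little theorem in `ℤ[i]`. -/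
lemma dvd_pow_norm_sub_one {α π : GaussianInt} (hπ : Prime π) (hodd : Odd π.norm)
    (h : ¬ π ∣ α) : π ∣ α ^ (π.norm.natAbs - 1) - 1 := by
  rcases prime_cases hπ hodd with ⟨p, hp, -, hN⟩ | ⟨p, hp, h3, hass⟩
  · have : Fact p.Prime := ⟨hp⟩
    obtain ⟨φ, hφ⟩ := exists_ringHom_zmod hN
    rw [← hφ] at h ⊢
    rw [hN, Int.natAbs_natCast, map_sub, map_pow, map_one, ZMod.pow_card_sub_one_eq_one h, sub_self]
  · have : Fact p.Prime := ⟨hp⟩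
    have hN : π.norm.natAbs = p ^ 2 := by
      rw [Zsqrtd.norm_eq_of_associated (by norm_num) hass, Zsqrtd.norm_natCast,
        Int.natAbs_mul, Int.natAbs_natCast, sq]
    have hfrob := natCast_dvd_pow_sub_star hp h3
    -- Frobenius is conjugation modulo p, so applying it twice is the identity.
    have h2 : (p : GaussianInt) ∣ α ^ p ^ 2 - α := by
      have h1 := hfrob (α ^ p)
      have h4 : star α ^ p - star (star α) = (star α) ^ p - α := by rw [star_star]
      have h5 := hfrob (star α)
      rw [h4] at h5
      rw [star_pow] at h1
      have := dvd_add h1 h5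
      rwa [← pow_mul, ← sq, sub_add_sub_cancel] at this
    have h6 : π ∣ α * (α ^ (π.norm.natAbs - 1) - 1) := by
      refine hass.dvd.trans ?_
      rw [mul_sub, mul_one, ← pow_succ', Nat.sub_add_cancel, hN]
      · exact h2
      · rw [hN]; exact Nat.one_le_pow _ _ hp.pos
    exact (hπ.dvd_or_dvd h6).resolve_left h

/-! ### The quartic residue symbol at a prime -/

open scoped Classical in
/-- The quartic residue symbol with values in `ℤ[i]`. -/
noncomputable def quarticResidue (α π : GaussianInt) : GaussianInt :=
  if π ∣ α ^ ((π.norm.natAbs - 1) / 4) - 1 then 1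
  else if π ∣ α ^ ((π.norm.natAbs - 1) / 4) - imUnit then imUnit
  else if π ∣ α ^ ((π.norm.natAbs - 1) / 4) + 1 then -1
  else if π ∣ α ^ ((π.norm.natAbs - 1) / 4) + imUnit then -imUnit
  else 0

/-- The quartic Jacobi symbol with values in `ℤ[i]`. -/
noncomputable def quarticJacobi (α β : GaussianInt) : GaussianInt :=
  ((UniqueFactorizationMonoid.factors β).map fun π => quarticResidue α π).prod

lemma toComplex_imUnit : toComplex imUnit = Complex.I := by
  simp [toComplex_def]

lemma toComplex_quarticResidue (α π : GaussianInt) :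
    toComplex (quarticResidue α π) = quarticResidueSymbol α π := by
  unfold quarticResidue quarticResidueSymbol
  simp only [apply_ite toComplex, map_one, map_neg, map_zero, toComplex_imUnit]
  rfl

lemma toComplex_quarticJacobi (α β : GaussianInt) :
    toComplex (quarticJacobi α β) = quarticJacobiSymbol α β := by
  unfold quarticJacobi quarticJacobiSymbol
  rw [map_multiset_prod, Multiset.map_map]
  simp only [Function.comp_def, toComplex_quarticResidue]

lemma isQuarticValue_quarticResidue (α π : GaussianInt) : IsQuarticValue (quarticResidue α π) := by
  unfold quarticResidue
  split_ifs
  · right; decide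
  · right; decide
  · right; decide
  · right; decide
  · left; rfl

lemma natAbs_norm_mod_four {α : GaussianInt} (h : Odd α.norm) : α.norm.natAbs % 4 = 1 := by
  have := norm_mod_four h
  have := GaussianInt.abs_natCast_norm α
  omega

lemma one_lt_natAbs_norm {π : GaussianInt} (hπ : Prime π) : 1 < π.norm.natAbs := by
  have h1 : π.norm.natAbs ≠ 1 := by rw [Ne, Zsqrtd.norm_eq_one_iff]; exact hπ.not_isUnit
  have h0 : π.norm.natAbs ≠ 0 := by
    rw [Int.natAbs_ne_zero]; exact (GaussianInt.norm_pos.mpr hπ.ne_zero).ne'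
  omega

/-- The defining congruence of the quartic residue symbol. -/
lemma dvd_pow_sub_quarticResidue {α π : GaussianInt} (hπ : Prime π) (hodd : Odd π.norm) :
    π ∣ α ^ ((π.norm.natAbs - 1) / 4) - quarticResidue α π := by
  have hmod := natAbs_norm_mod_four hodd
  have hlt := one_lt_natAbs_norm hπ
  by_cases hα : π ∣ α
  · unfold quarticResidue
    split_ifs with h1 h2 h3 h4
    · exact h1
    · exact h2
    · simpa using h3
    · simpa using h4
    · rw [sub_zero]
      exact hα.trans (dvd_pow_self _ (by omega))
  · have h := dvd_pow_norm_sub_one hπ hodd hα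
    have e : π.norm.natAbs - 1 = (π.norm.natAbs - 1) / 4 * 4 := by omega
    rw [e, pow_mul] at h
    set β := α ^ ((π.norm.natAbs - 1) / 4) with hβ
    -- This product is β⁴ - 1, so Fermat's theorem makes one factor divisible by π and the value 0
    -- cannot occur.
    have : π ∣ (β - 1) * ((β - imUnit) * ((β + 1) * (β + imUnit))) := by
      convert h using 1
      linear_combination (1 - β ^ 2) * imUnit_sq
    unfold quarticResidue
    rw [← hβ]
    split_ifs with h1 h2 h3 h4
    · exact h1
    · exact h2
    · simpa using h3
    · simpa using h4
    · exfalso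
      rcases hπ.dvd_or_dvd this with h | h
      · exact h1 h
      rcases hπ.dvd_or_dvd h with h | h
      · exact h2 h
      rcases hπ.dvd_or_dvd h with h | h
      · exact h3 h
      · exact h4 h

/-- Quartic values are separated modulo π, so the congruence determines the symbol. All rules for
the symbol are deduced from this. -/
lemma quarticResidue_eq_of_dvd {α π u : GaussianInt} (hπ : Prime π) (hodd : Odd π.norm)
    (hu : IsQuarticValue u) (h : π ∣ α ^ ((π.norm.natAbs - 1) / 4) - u) :
    quarticResidue α π = u := by
  refine (isQuarticValue_quarticResidue α π).eq_of_dvd_sub hodd hπ.not_isUnit hu ?_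
  have := dvd_sub h (dvd_pow_sub_quarticResidue (α := α) hπ hodd)
  rwa [sub_sub_sub_cancel_left] at this

lemma quarticResidue_congr {α α' π : GaussianInt} (hπ : Prime π) (hodd : Odd π.norm)
    (h : π ∣ α - α') : quarticResidue α π = quarticResidue α' π := by
  refine quarticResidue_eq_of_dvd hπ hodd (isQuarticValue_quarticResidue _ _) ?_
  have := dvd_add (h.trans (sub_dvd_pow_sub_pow α α' ((π.norm.natAbs - 1) / 4)))
    (dvd_pow_sub_quarticResidue (α := α') hπ hodd)
  rwa [sub_add_sub_cancel] at this

lemma quarticResidue_mul (α α' : GaussianInt) {π : GaussianInt} (hπ : Prime π)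
    (hodd : Odd π.norm) :
    quarticResidue (α * α') π = quarticResidue α π * quarticResidue α' π := by
  refine quarticResidue_eq_of_dvd hπ hodd
    ((isQuarticValue_quarticResidue _ _).mul (isQuarticValue_quarticResidue _ _)) ?_
  have h1 := dvd_pow_sub_quarticResidue (α := α) hπ hodd
  have h2 := dvd_pow_sub_quarticResidue (α := α') hπ hodd
  rw [mul_pow]
  have := dvd_add (h1.mul_right (α' ^ ((π.norm.natAbs - 1) / 4)))
    (h2.mul_left (quarticResidue α π))
  convert this using 1
  ring

lemma quarticResidue_eq_zero_iff {α π : GaussianInt} (hπ : Prime π) (hodd : Odd π.norm) :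
    quarticResidue α π = 0 ↔ π ∣ α := by
  constructor
  · intro h
    have := dvd_pow_sub_quarticResidue (α := α) hπ hodd
    rw [h, sub_zero] at this
    exact hπ.dvd_of_dvd_pow this
  · intro h
    refine quarticResidue_eq_of_dvd hπ hodd (Or.inl rfl) ?_
    rw [sub_zero]
    have hmod := natAbs_norm_mod_four hodd
    have hlt := one_lt_natAbs_norm hπ
    exact h.trans (dvd_pow_self _ (by omega))

lemma quarticResidue_pow_four {α π : GaussianInt} (hπ : Prime π) (hodd : Odd π.norm)
    (h : ¬ π ∣ α) : quarticResidue α π ^ 4 = 1 :=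
  (isQuarticValue_quarticResidue α π).resolve_left
    (by rwa [quarticResidue_eq_zero_iff hπ hodd])

lemma quarticResidue_of_associated (α : GaussianInt) {π π' : GaussianInt} (h : Associated π π') :
    quarticResidue α π = quarticResidue α π' := by
  unfold quarticResidue
  rw [Zsqrtd.norm_eq_of_associated (by norm_num) h]
  classical simp only [h.dvd_iff_dvd_left]

/-- Conjugation preserves the norm, hence the exponent, and carries the defining congruence modulo π
to one modulo its conjugate. -/
lemma quarticResidue_star (α : GaussianInt) {π : GaussianInt} (hπ : Prime π)
    (hodd : Odd π.norm) : quarticResidue (star α) (star π) = star (quarticResidue α π) := by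
  have hstar : ∀ {a b : GaussianInt}, a ∣ b → star a ∣ star b := by
    rintro a _ ⟨c, rfl⟩
    exact ⟨star c, by rw [star_mul, mul_comm]⟩
  have hπ' : Prime (star π) := by
    have := (MulEquiv.prime_iff (p := π) (starMulAut (R := GaussianInt))).mpr hπ
    exact this
  refine quarticResidue_eq_of_dvd hπ' (by rwa [Zsqrtd.norm_conj]) ?_ ?_
  · rcases isQuarticValue_quarticResidue α π with h | h
    · left; rw [h, star_zero]
    · right; rw [← star_pow, h, star_one]
  · have := hstar (dvd_pow_sub_quarticResidue (α := α) hπ hodd)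
    rwa [star_sub, star_pow, ← Zsqrtd.norm_conj] at this

/-! ### The quartic Jacobi symbol -/

lemma prod_quarticResidue_of_rel (α : GaussianInt) {s t : Multiset GaussianInt}
    (h : Multiset.Rel Associated s t) :
    (s.map fun π => quarticResidue α π).prod = (t.map fun π => quarticResidue α π).prod := by
  induction h with
  | zero => rfl
  | cons hab _ ih => simp [quarticResidue_of_associated α hab, ih]

lemma quarticJacobi_of_associated (α : GaussianInt) {β β' : GaussianInt} (h : Associated β β') :
    quarticJacobi α β = quarticJacobi α β' :=
  prod_quarticResidue_of_rel α (UniqueFactorizationMonoid.factors_rel_of_associated h)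

lemma quarticJacobi_mul_right (α : GaussianInt) {β β' : GaussianInt} (h : β ≠ 0) (h' : β' ≠ 0) :
    quarticJacobi α (β * β') = quarticJacobi α β * quarticJacobi α β' := by
  unfold quarticJacobi
  rw [prod_quarticResidue_of_rel α (UniqueFactorizationMonoid.factors_mul h h'),
    Multiset.map_add, Multiset.prod_add]

lemma quarticJacobi_of_isUnit (α : GaussianInt) {β : GaussianInt} (h : IsUnit β) :
    quarticJacobi α β = 1 := by
  unfold quarticJacobi
  rw [UniqueFactorizationMonoid.factors_of_isUnit h]; rfl

lemma quarticJacobi_of_prime (α : GaussianInt) {π : GaussianInt} (h : Prime π) :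
    quarticJacobi α π = quarticResidue α π := by
  obtain ⟨κ, hκ, hf⟩ :=
    UniqueFactorizationMonoid.factors_eq_singleton_of_irreducible h.irreducible
  unfold quarticJacobi
  rw [hf, Multiset.map_singleton, Multiset.prod_singleton, quarticResidue_of_associated α hκ]

/-- Induction over the elements of odd norm. -/
lemma induction_odd_norm {P : (α : GaussianInt) → Odd α.norm → Prop}
    (hu : ∀ u h, IsUnit u → P u h) (hp : ∀ π h, Prime π → P π h)
    (hm : ∀ α β hα hβ h, P α hα → P β hβ → P (α * β) h)
    (α : GaussianInt) (h : Odd α.norm) : P α h := by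
  revert h
  induction α using UniqueFactorizationMonoid.induction_on_prime with
  | h₁ => intro h; exact absurd rfl (ne_zero_of_odd_norm h)
  | h₂ u hu' => exact fun h => hu u h hu'
  | h₃ a p ha hpp ih =>
    intro h
    have h1 := odd_norm_of_dvd (dvd_mul_right p a) h
    have h2 := odd_norm_of_dvd (dvd_mul_left a p) h
    exact hm p a h1 h2 h (hp p h1 hpp) (ih h2)

lemma quarticJacobi_mul_left (α α' : GaussianInt) {β : GaussianInt} (h : Odd β.norm) :
    quarticJacobi (α * α') β = quarticJacobi α β * quarticJacobi α' β := by
  induction β, h using induction_odd_norm with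
  | hu u _ h => simp only [quarticJacobi_of_isUnit _ h, one_mul]
  | hp π h' h => simp only [quarticJacobi_of_prime _ h, quarticResidue_mul _ _ h h']
  | hm a b ha hb _ iha ihb =>
    simp only [quarticJacobi_mul_right _ (ne_zero_of_odd_norm ha) (ne_zero_of_odd_norm hb), iha, ihb]
    ring

lemma quarticJacobi_congr {α α' β : GaussianInt} (h : Odd β.norm) (hd : β ∣ α - α') :
    quarticJacobi α β = quarticJacobi α' β := by
  induction β, h using induction_odd_norm with
  | hu u _ h => simp only [quarticJacobi_of_isUnit _ h]
  | hp π h' h => simp only [quarticJacobi_of_prime _ h, quarticResidue_congr h h' hd]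
  | hm a b ha hb _ iha ihb =>
    simp only [quarticJacobi_mul_right _ (ne_zero_of_odd_norm ha) (ne_zero_of_odd_norm hb),
      iha (dvd_of_mul_right_dvd hd), ihb (dvd_of_mul_left_dvd hd)]

lemma quarticJacobi_pow_four {α β : GaussianInt} (h : Odd β.norm) (hc : IsCoprime α β) :
    quarticJacobi α β ^ 4 = 1 := by
  induction β, h using induction_odd_norm with
  | hu u _ h => simp only [quarticJacobi_of_isUnit _ h, one_pow]
  | hp π h' h =>
    rw [quarticJacobi_of_prime _ h, quarticResidue_pow_four h h']
    exact fun hd => h.not_isUnit (hc.isUnit_of_dvd' hd dvd_rfl)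
  | hm a b ha hb _ iha ihb =>
    rw [quarticJacobi_mul_right _ (ne_zero_of_odd_norm ha) (ne_zero_of_odd_norm hb), mul_pow,
      iha hc.of_mul_right_left, ihb hc.of_mul_right_right, one_mul]

lemma quarticJacobi_one_left {β : GaussianInt} (h : Odd β.norm) : quarticJacobi 1 β = 1 := by
  have h1 := quarticJacobi_mul_left 1 1 h
  have h4 := quarticJacobi_pow_four h (isCoprime_one_left (x := β))
  rw [mul_one] at h1
  set s := quarticJacobi 1 β
  linear_combination h4 + (1 + s + s ^ 2) * h1

lemma quarticJacobi_pow_left (α : GaussianInt) (n : ℕ) {β : GaussianInt} (h : Odd β.norm) :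
    quarticJacobi (α ^ n) β = quarticJacobi α β ^ n := by
  induction n with
  | zero => rw [pow_zero, pow_zero, quarticJacobi_one_left h]
  | succ n ih => rw [pow_succ, pow_succ, quarticJacobi_mul_left _ _ h, ih]

lemma imUnit_pow_mod (n : ℕ) : imUnit ^ n = imUnit ^ (n % 4) := by
  conv_lhs => rw [← Nat.div_add_mod n 4, pow_add, pow_mul, imUnit_pow_four, one_pow, one_mul]

lemma imUnit_pow_congr {m n : ℕ} (h : m ≡ n [MOD 4]) : imUnit ^ m = imUnit ^ n := by
  rw [imUnit_pow_mod m, imUnit_pow_mod n, h]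

/-- At a prime this is the definition. In general n ↦ (n - 1)/4 turns products of integers n ≡ 1
(mod 4) into sums modulo 4. -/
lemma quarticJacobi_imUnit_left {β : GaussianInt} (h : Odd β.norm) :
    quarticJacobi imUnit β = imUnit ^ ((β.norm.natAbs - 1) / 4) := by
  induction β, h using induction_odd_norm with
  | hu u _ h =>
    rw [quarticJacobi_of_isUnit _ h, Zsqrtd.norm_eq_one_iff.mpr h]; rfl
  | hp π h' h =>
    rw [quarticJacobi_of_prime _ h]
    refine quarticResidue_eq_of_dvd h h' (Or.inr ?_) (by rw [sub_self]; exact dvd_zero _)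
    rw [← pow_mul, mul_comm, pow_mul, imUnit_pow_four, one_pow]
  | hm a b ha hb _ iha ihb =>
    rw [quarticJacobi_mul_right _ (ne_zero_of_odd_norm ha) (ne_zero_of_odd_norm hb),
      iha, ihb, ← pow_add, Zsqrtd.norm_mul, Int.natAbs_mul]
    apply imUnit_pow_congr
    have h1 := natAbs_norm_mod_four ha
    have h2 := natAbs_norm_mod_four hb
    obtain ⟨m, hm⟩ : ∃ m, a.norm.natAbs = 4 * m + 1 := ⟨a.norm.natAbs / 4, by omega⟩
    obtain ⟨n, hn⟩ : ∃ n, b.norm.natAbs = 4 * n + 1 := ⟨b.norm.natAbs / 4, by omega⟩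
    have e1 : ((4 * m + 1) * (4 * n + 1) - 1) / 4 = m + n + 4 * (m * n) := by
      have : (4 * m + 1) * (4 * n + 1) = 4 * (m + n + 4 * (m * n)) + 1 := by ring
      omega
    rw [hm, hn, e1]
    have e2 : (4 * m + 1 - 1) / 4 = m := by omega
    have e3 : (4 * n + 1 - 1) / 4 = n := by omega
    rw [e2, e3]
    simp [Nat.ModEq]

/-! ### Symbols between rational integers -/

lemma prime_star {π : GaussianInt} (hπ : Prime π) : Prime (star π) :=
  (MulEquiv.prime_iff (p := π) (starMulAut (R := GaussianInt))).mpr hπ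

lemma exists_norm_eq_prime {p : ℕ} (hp : p.Prime) (h : p % 4 = 1) :
    ∃ π : GaussianInt, π.norm = p := by
  have : Fact p.Prime := ⟨hp⟩
  obtain ⟨a, b, hab⟩ := Nat.Prime.sq_add_sq (p := p) (by omega)
  exact ⟨⟨a, b⟩, by rw [norm_eq]; dsimp only; exact_mod_cast hab⟩

lemma natCast_eq_mul_star {π : GaussianInt} {p : ℕ} (h : π.norm = p) :
    (p : GaussianInt) = π * star π := by
  rw [← Zsqrtd.norm_eq_mul_conj, h, Int.cast_natCast]

lemma odd_norm_intCast {n : ℤ} : Odd (n : GaussianInt).norm ↔ Odd n := by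
  rw [Zsqrtd.norm_intCast, Int.odd_mul, and_self]

lemma odd_norm_natCast {n : ℕ} : Odd (n : GaussianInt).norm ↔ Odd n := by
  rw [← Int.cast_natCast, odd_norm_intCast, Int.odd_coe_nat]

lemma prime_natCast {p : ℕ} (hp : p.Prime) (h : p % 4 = 3) : Prime (p : GaussianInt) :=
  have : Fact p.Prime := ⟨hp⟩
  GaussianInt.prime_of_nat_prime_of_mod_four_eq_three p h

lemma odd_of_norm_eq {π : GaussianInt} {p : ℕ} (h : π.norm = p) (hp : p % 4 = 1) :
    Odd π.norm := by
  rw [h, Int.odd_coe_nat, Nat.odd_iff]; omega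

lemma quarticJacobi_natCast_of_norm_eq (α : GaussianInt) {π : GaussianInt} {p : ℕ}
    (hp : p.Prime) (h : π.norm = p) :
    quarticJacobi α p = quarticResidue α π * quarticResidue α (star π) := by
  have hπ := prime_of_norm_eq_prime hp h
  rw [natCast_eq_mul_star h, quarticJacobi_mul_right _ hπ.ne_zero (prime_star hπ).ne_zero,
    quarticJacobi_of_prime _ hπ, quarticJacobi_of_prime _ (prime_star hπ)]

lemma not_dvd_of_isCoprime {π α : GaussianInt} (hπ : Prime π) (h : IsCoprime α π) : ¬ π ∣ α :=
  fun hd => hπ.not_isUnit (h.isUnit_of_dvd' hd dvd_rfl)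

lemma isCoprime_of_not_dvd {π α : GaussianInt} (hπ : Prime π) (h : ¬ π ∣ α) : IsCoprime α π :=
  ((hπ.irreducible.coprime_iff_not_dvd).mpr h).symm

/-- Rational integers are quartic residues of each other. -/
lemma quarticJacobi_intCast_natCast (n : ℤ) (m : ℕ) (hm : Odd m) (h : IsCoprime n (m : ℤ)) :
    quarticJacobi n m = 1 := by
  induction m using Nat.recOnMul with
  | zero => exact absurd hm (by decide)
  | one => exact quarticJacobi_of_isUnit _ (by simp)
  | prime l hl =>
    have : Fact l.Prime := ⟨hl⟩
    have hndvd : ¬ (l : ℤ) ∣ n := fun hd =>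
      (Nat.prime_iff_prime_int.mp hl).not_isUnit (h.isUnit_of_dvd' hd dvd_rfl)
    have hn0 : (n : ZMod l) ≠ 0 := by rwa [Ne, ZMod.intCast_zmod_eq_zero_iff_dvd]
    have hl4 : l % 4 = 1 ∨ l % 4 = 3 := by rw [Nat.odd_iff] at hm; omega
    rcases hl4 with hl4 | hl4
    -- For split l the two factors are conjugate and n is real, so the two symbols are conjugate and
    -- their product is 1.
    · obtain ⟨π, hN⟩ := exists_norm_eq_prime hl hl4
      have hπ := prime_of_norm_eq_prime hl hN
      have hodd := odd_of_norm_eq hN hl4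
      rw [quarticJacobi_natCast_of_norm_eq _ hl hN]
      have hst : star (n : GaussianInt) = n := by ext <;> simp
      rw [← congrArg (quarticResidue · (star π)) hst, quarticResidue_star _ hπ hodd]
      refine mul_star_of_pow_four (quarticResidue_pow_four hπ hodd fun hd => hndvd ?_)
      have := norm_dvd_norm hd
      rw [hN, Zsqrtd.norm_intCast] at this
      exact (or_self_iff.mp ((Nat.prime_iff_prime_int.mp hl).dvd_or_dvd this))
    · have hπ := prime_natCast hl hl4
      rw [quarticJacobi_of_prime _ hπ]
      refine quarticResidue_eq_of_dvd hπ (odd_norm_natCast.mpr hm) (Or.inr (one_pow 4)) ?_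
      have : (l : ℤ) ∣ n ^ ((l * l - 1) / 4) - 1 := by
        rw [← ZMod.intCast_zmod_eq_zero_iff_dvd]
        push_cast
        obtain ⟨k, hk⟩ : ∃ k, l = 4 * k + 3 := ⟨l / 4, by omega⟩
        -- For inert l, 4 divides l + 1, so the exponent is a multiple of l - 1 and Fermat's theorem
        -- in `ZMod l` applies.
        have e : (l * l - 1) / 4 = (l - 1) * (k + 1) := by
          have h1 : l - 1 = 4 * k + 2 := by omega
          have h2 : l * l = 4 * ((4 * k + 2) * (k + 1)) + 1 := by rw [hk]; ring
          rw [h1]; omega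
        rw [e, pow_mul, ZMod.pow_card_sub_one_eq_one hn0, one_pow, sub_self]
      obtain ⟨c, hc⟩ := this
      refine ⟨c, ?_⟩
      rw [Zsqrtd.norm_natCast, Int.natAbs_mul, Int.natAbs_natCast]
      exact_mod_cast congrArg (Int.cast : ℤ → GaussianInt) hc
  | mul a b iha ihb =>
    obtain ⟨ha, hb⟩ := Nat.odd_mul.mp hm
    push_cast at h ⊢
    rw [quarticJacobi_mul_right _ (ne_zero_of_odd_norm (odd_norm_natCast.mpr ha))
      (ne_zero_of_odd_norm (odd_norm_natCast.mpr hb)), iha ha h.of_mul_right_left,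
      ihb hb h.of_mul_right_right, one_mul]

lemma associated_natAbs (m : ℤ) : Associated (m : GaussianInt) (m.natAbs : GaussianInt) := by
  rcases Int.natAbs_eq m with h | h
  · rw [← Int.cast_natCast, ← h]
  · conv_lhs => rw [h]
    rw [Int.cast_neg, Int.cast_natCast]
    exact (Associated.refl _).neg_left

lemma isCoprime_natAbs_right {n m : ℤ} (h : IsCoprime n m) : IsCoprime n (m.natAbs : ℤ) := by
  rcases Int.natAbs_eq m with h' | h'
  · rwa [← h']
  · rw [h'] at h; exact (IsCoprime.neg_right_iff _ _).mp h

lemma quarticJacobi_intCast_intCast {n m : ℤ} (hm : Odd m) (h : IsCoprime n m) :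
    quarticJacobi n m = 1 := by
  rw [quarticJacobi_of_associated _ (associated_natAbs m)]
  exact quarticJacobi_intCast_natCast n _ (Int.natAbs_odd.mpr hm) (isCoprime_natAbs_right h)

/-! ### Integral powers of the imaginary unit -/

/-- The integral power `i ^ e` in `ℤ[i]`. -/
noncomputable def iPow (e : ℤ) : GaussianInt := ((isUnit_imUnit.unit ^ e : GaussianIntˣ) : GaussianInt)

lemma iPow_add (e f : ℤ) : iPow (e + f) = iPow e * iPow f := by
  simp [iPow, zpow_add]

lemma iPow_natCast (n : ℕ) : iPow n = imUnit ^ n := by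
  simp [iPow]

@[simp] lemma iPow_zero : iPow 0 = 1 := by simp [iPow]

@[simp] lemma iPow_one : iPow 1 = imUnit := by simp [iPow]

lemma iPow_two : iPow 2 = -1 := by
  rw [← imUnit_sq, ← iPow_natCast]; rfl

lemma iPow_pow (e : ℤ) (n : ℕ) : iPow e ^ n = iPow (e * n) := by
  simp [iPow, zpow_mul]

lemma iPow_four_mul (e : ℤ) : iPow (4 * e) = 1 := by
  have : isUnit_imUnit.unit ^ (4 : ℤ) = 1 := by
    ext1; exact imUnit_pow_four
  rw [iPow, zpow_mul, this, one_zpow, Units.val_one]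

lemma iPow_congr {e f : ℤ} (h : e ≡ f [ZMOD 4]) : iPow e = iPow f := by
  obtain ⟨k, hk⟩ := h.dvd
  rw [show f = e + 4 * k by lia, iPow_add, iPow_four_mul, mul_one]

lemma isUnit_iPow (e : ℤ) : IsUnit (iPow e) := Units.isUnit _

lemma iPow_pow_four (e : ℤ) : iPow e ^ 4 = 1 := pow_four_of_isUnit (isUnit_iPow e)

lemma exists_eq_iPow {u : GaussianInt} (h : u ^ 4 = 1) : ∃ e, u = iPow e := by
  obtain ⟨k, hk⟩ := eq_imUnit_pow h
  exact ⟨k, by rw [hk, iPow_natCast]⟩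

lemma quarticJacobi_imUnit {β : GaussianInt} (h : Odd β.norm) :
    quarticJacobi imUnit β = iPow ((β.norm - 1) / 4) := by
  rw [quarticJacobi_imUnit_left h, ← iPow_natCast]
  have h1 := natAbs_norm_mod_four h
  have h2 := GaussianInt.abs_natCast_norm β
  congr 1
  omega

lemma quarticJacobi_iPow (e : ℤ) {β : GaussianInt} (h : Odd β.norm) :
    quarticJacobi (iPow e) β = iPow ((β.norm - 1) / 4 * e) := by
  have h1 : iPow e = iPow 1 ^ (e % 4).toNat := by
    rw [iPow_pow]
    apply iPow_congr
    rw [Int.toNat_of_nonneg (Int.emod_nonneg _ (by norm_num)), one_mul]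
    exact (Int.mod_modEq _ _).symm
  rw [h1, quarticJacobi_pow_left _ _ h, iPow_one, quarticJacobi_imUnit h, iPow_pow]
  apply iPow_congr
  rw [Int.toNat_of_nonneg (Int.emod_nonneg _ (by norm_num))]
  exact (Int.mod_modEq _ _).mul_left _

/-! ### Elements of odd norm with even imaginary part -/

lemma even_im_mul {α β : GaussianInt} (ha : Even α.im) (hb : Even β.im) : Even (α * β).im := by
  rw [Zsqrtd.im_mul]; exact (hb.mul_left _).add (ha.mul_right _)

lemma exists_isUnit_even_im {α : GaussianInt} (h : Odd α.norm) :
    ∃ v w : GaussianInt, w * v = 1 ∧ Even (v * α).im := by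
  by_cases h' : Even α.im
  · exact ⟨1, 1, one_mul 1, by rwa [one_mul]⟩
  · refine ⟨imUnit, -imUnit, by decide, ?_⟩
    rw [← odd_iff_of_odd_norm h, Int.not_odd_iff_even] at h'
    simpa using h'

lemma odd_norm_mul {α β : GaussianInt} (ha : Odd α.norm) (hb : Odd β.norm) :
    Odd (α * β).norm := by
  rw [Zsqrtd.norm_mul]; exact ha.mul hb

lemma odd_norm_of_isUnit {u : GaussianInt} (h : IsUnit u) : Odd u.norm := by
  rw [(Zsqrtd.norm_eq_one_iff' (by norm_num) u).mpr h]; exact odd_one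

/-- Induction over the elements of odd norm with even imaginary part. -/
lemma induction_even_im {P : GaussianInt → Prop}
    (hu : ∀ u, IsUnit u → Even u.im → P u)
    (hp : ∀ π, Prime π → Odd π.norm → Even π.im → P π)
    (hm : ∀ α β, Odd α.norm → Odd β.norm → Even α.im → Even β.im → P α → P β → P (α * β))
    (α : GaussianInt) (h : Odd α.norm) (h' : Even α.im) : P α := by
  suffices ∀ u, IsUnit u → Even (u * α).im → P (u * α) by
    simpa using this 1 isUnit_one (by rwa [one_mul])
  clear h'
  refine induction_odd_norm (P := fun α _ => ∀ u, IsUnit u → Even (u * α).im → P (u * α))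
    (fun v _ hv u huu he => hu _ (huu.mul hv) he) (fun π ho hπ u huu he => ?_)
    (fun a b ha hb _ iha ihb u huu he => ?_) α h
  · have hass : Associated π (u * π) := (associated_unit_mul_right π u huu)
    exact hp _ (hass.prime_iff.mp hπ) (odd_norm_mul (odd_norm_of_isUnit huu) ho) he
  -- The factors are rotated to have even imaginary part. The unit left over then also has even
  -- imaginary part, since the whole product does.
  · obtain ⟨v, v', hv, hva⟩ := exists_isUnit_even_im ha
    obtain ⟨w, w', hw, hwb⟩ := exists_isUnit_even_im hb
    have hv1 : IsUnit v := IsUnit.of_mul_eq_one v' (by rw [mul_comm, hv])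
    have hv2 : IsUnit v' := IsUnit.of_mul_eq_one v hv
    have hw1 : IsUnit w := IsUnit.of_mul_eq_one w' (by rw [mul_comm, hw])
    have hw2 : IsUnit w' := IsUnit.of_mul_eq_one w hw
    have e : u * (a * b) = (u * v' * w') * ((v * a) * (w * b)) := by
      linear_combination (-u * (a * b) * w' * w) * hv - u * (a * b) * hw
    have hu' : IsUnit (u * v' * w') := (huu.mul hv2).mul hw2
    have hγ := even_im_mul hva hwb
    have oa := odd_norm_mul (odd_norm_of_isUnit hv1) ha
    have ob := odd_norm_mul (odd_norm_of_isUnit hw1) hb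
    have hγo := odd_norm_mul oa ob
    rw [e] at he ⊢
    have hev : Even (u * v' * w').im := by
      have hre := (odd_iff_of_odd_norm hγo).mpr hγ
      rw [Zsqrtd.im_mul] at he
      have := (Int.even_add.mp he).mp (hγ.mul_left _)
      exact (Int.even_mul.mp this).resolve_right (Int.not_even_iff_odd.mpr hre)
    exact hm _ _ (odd_norm_of_isUnit hu') hγo hev hγ (hu _ hu' hev)
      (hm _ _ oa ob hva hwb (iha v hv1 hva) (ihb w hw1 hwb))

/-! ### The quartic character of `2` -/

/-- As p ≡ 1 (mod 4), -1 is a square modulo p, so the sign of s is irrelevant and quadratic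
reciprocity has no sign. -/
lemma legendreSym_eq_jacobiSym_natAbs {p : ℕ} [Fact p.Prime] (hp : p % 4 = 1) {s : ℤ}
    (hs : Odd s) : legendreSym p s = jacobiSym p s.natAbs := by
  have hodd : Odd p := by rw [Nat.odd_iff]; omega
  have h1 : legendreSym p s = jacobiSym (s.natAbs : ℤ) p := by
    rw [jacobiSym.legendreSym.to_jacobiSym]
    rcases Int.natAbs_eq s with h | h
    · rw [← h]
    · conv_lhs => rw [h]
      rw [jacobiSym.neg _ hodd, ZMod.χ₄_nat_one_mod_four hp, one_mul]
  rw [h1, jacobiSym.quadratic_reciprocity_one_mod_four' (Int.natAbs_odd.mpr hs) hp]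

lemma isCoprime_of_sq_add_sq_eq_prime {p : ℕ} (hp : p.Prime) {a b : ℤ}
    (h : a ^ 2 + b ^ 2 = p) : IsCoprime a b := by
  rw [Int.isCoprime_iff_gcd_eq_one]
  have h1 : ((Int.gcd a b : ℕ) : ℤ) * (Int.gcd a b : ℕ) ∣ p := by
    rw [← h, sq, sq]
    exact dvd_add (mul_dvd_mul (Int.gcd_dvd_left ..) (Int.gcd_dvd_left ..))
      (mul_dvd_mul (Int.gcd_dvd_right ..) (Int.gcd_dvd_right ..))
  have h2 : Int.gcd a b * Int.gcd a b ∣ p := by exact_mod_cast h1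
  exact Nat.isUnit_iff.mp ((Nat.prime_iff.mp hp).irreducible.squarefree _ h2)

/-- After reciprocity, p ≡ b² is a square modulo |a|. -/
lemma legendreSym_sum_two_squares {p : ℕ} [Fact p.Prime] (hp : p % 4 = 1) {a b : ℤ}
    (h : a ^ 2 + b ^ 2 = p) (ha : Odd a) : legendreSym p a = 1 := by
  have hc := isCoprime_of_sq_add_sq_eq_prime Fact.out h
  rw [legendreSym_eq_jacobiSym_natAbs hp ha]
  have e : ((p : ℤ)) % (a.natAbs : ℤ) = b ^ 2 % (a.natAbs : ℤ) := by
    rw [← h]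
    apply Int.emod_emod_of_dvd _ (dvd_refl _) |>.symm.trans
    rw [Int.emod_emod_of_dvd _ (dvd_refl _), Int.add_emod,
      Int.emod_eq_zero_of_dvd (Int.natAbs_dvd.mpr (dvd_pow_self a two_ne_zero)), zero_add,
      Int.emod_emod_of_dvd _ (dvd_refl _)]
  rw [jacobiSym.mod_left' e]
  apply jacobiSym.sq_one'
  rw [← Int.isCoprime_iff_gcd_eq_one]
  exact isCoprime_natAbs_right hc.symm

/-- From 2p = (a+b)² + (a-b)², 2p is a square modulo |a+b|, so p and 2 have the same Jacobi symbol
there. -/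
lemma legendreSym_sum_two_squares_add {p : ℕ} [Fact p.Prime] (hp : p % 4 = 1) {a b : ℤ}
    (h : a ^ 2 + b ^ 2 = p) (ha : Odd a) (hb : Even b) :
    legendreSym p (a + b) = ZMod.χ₈ ((a + b).natAbs : ℕ) := by
  have hc := isCoprime_of_sq_add_sq_eq_prime Fact.out h
  have hs : Odd (a + b) := ha.add_even hb
  rw [legendreSym_eq_jacobiSym_natAbs hp hs, ← jacobiSym.at_two (Int.natAbs_odd.mpr hs)]
  have h2s : IsCoprime (2 : ℤ) (a + b) := Int.isCoprime_two_left.mpr hs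
  have hcop : IsCoprime (a - b) (a + b) := by
    have h1 : IsCoprime (a + b) a := by
      have := (IsCoprime.add_mul_left_left hc.symm 1)
      rwa [mul_one, add_comm] at this
    have h2 : IsCoprime (a + b) (2 * a) := h2s.symm.mul_right h1
    have := h2.add_mul_left_right (-1)
    rw [show 2 * a + (a + b) * -1 = a - b by ring] at this
    exact this.symm
  have h1 : jacobiSym 2 (a + b).natAbs * jacobiSym p (a + b).natAbs = 1 := by
    rw [← jacobiSym.mul_left]
    have e : (2 * (p : ℤ)) % ((a + b).natAbs : ℤ) = (a - b) ^ 2 % ((a + b).natAbs : ℤ) := by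
      apply Int.ModEq.symm
      rw [Int.modEq_iff_dvd, Int.natAbs_dvd]
      exact ⟨a + b, by rw [← h]; ring⟩
    rw [jacobiSym.mod_left' e]
    apply jacobiSym.sq_one'
    rw [← Int.isCoprime_iff_gcd_eq_one]
    exact isCoprime_natAbs_right hcop
  have h2 : jacobiSym 2 (a + b).natAbs ^ 2 = 1 := by
    apply jacobiSym.sq_one
    rw [← Int.isCoprime_iff_gcd_eq_one]
    exact isCoprime_natAbs_right h2s
  linear_combination (jacobiSym 2 (a + b).natAbs) * h1 - jacobiSym p (a + b).natAbs * h2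

lemma chi_eight_exponent {a b m : ℤ} (ha : Odd a) (hb : Even b) (hm : a ^ 2 + b ^ 2 = 4 * m + 1) :
    ((ZMod.χ₈ ((a + b).natAbs : ℕ) : ℤ) : GaussianInt) = iPow (a * b / 2 + m) := by
  have hs : (a + b).natAbs % 2 = 1 := by
    have := ha.add_even hb
    rw [Int.odd_iff] at this; omega
  rw [ZMod.χ₈_nat_eq_if_mod_eight, if_neg (by omega)]
  obtain ⟨a, rfl⟩ := ha
  obtain ⟨b, rfl⟩ := hb.two_dvd
  have e1 : (2 * a + 1) * (2 * b) / 2 = (2 * a + 1) * b :=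
    Int.ediv_eq_of_eq_mul_left two_ne_zero (by ring)
  have e2 : m = a * (a + 1) + b ^ 2 := by linarith
  rw [e1, e2]
  -- Now a and b are the halves: the original sum is 2(a + b) + 1, which is ±1 modulo 8 exactly when
  -- a + b is 0 or 3 modulo 4.
  have key : ((2 * a + 1) * b + (a * (a + 1) + b ^ 2)) % 4 =
      if (a + b) % 4 = 0 ∨ (a + b) % 4 = 3 then 0 else 2 := by
    obtain ⟨k, r, ha, hr0, hr4⟩ : ∃ k r : ℤ, a = 4 * k + r ∧ 0 ≤ r ∧ r < 4 :=
      ⟨a / 4, a % 4, by lia, by lia, by lia⟩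
    obtain ⟨l, t, hb, ht0, ht4⟩ : ∃ k r : ℤ, b = 4 * k + r ∧ 0 ≤ r ∧ r < 4 :=
      ⟨b / 4, b % 4, by lia, by lia, by lia⟩
    have e3 : (2 * a + 1) * b + (a * (a + 1) + b ^ 2) = (2 * r + 1) * t + (r * (r + 1) + t ^ 2) +
        4 * (8 * k * l + 2 * k * t + 2 * r * l + l + 4 * k ^ 2 + 2 * k * r + k + 4 * l ^ 2 +
          2 * l * t) := by rw [ha, hb]; ring
    have e4 : a + b = r + t + 4 * (k + l) := by rw [ha, hb]; ring
    rw [e3, e4, Int.add_mul_emod_self_left, Int.add_mul_emod_self_left]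
    interval_cases r <;> interval_cases t <;> rfl
  by_cases h4 : (a + b) % 4 = 0 ∨ (a + b) % 4 = 3
  · rw [if_pos h4] at key
    rw [if_pos (by omega), iPow_congr (f := 0) key, iPow_zero, Int.cast_one]
  · rw [if_neg h4] at key
    rw [if_neg (by omega), iPow_congr (f := 2) key, iPow_two]; simp

/-- Modulo π = a + bi one has b ≡ ai, so (a+b)² ≡ 2ia². Raising to the power (p-1)/4 produces
Legendre symbols of a + b and a, both known, beside the quartic symbols of 2 and i. -/
lemma quarticResidue_two {π : GaussianInt} {p : ℕ} (hp : p.Prime) (hp4 : p % 4 = 1)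
    (hN : π.norm = p) (him : Even π.im) :
    quarticResidue 2 π = iPow (π.re * π.im / 2) := by
  have : Fact p.Prime := ⟨hp⟩
  have hπ := prime_of_norm_eq_prime hp hN
  have hodd := odd_of_norm_eq hN hp4
  have hre := (odd_iff_of_odd_norm hodd).mpr him
  obtain ⟨φ, hφ⟩ := exists_ringHom_zmod hN
  refine quarticResidue_eq_of_dvd hπ hodd (Or.inr (iPow_pow_four _)) ?_
  rw [← hφ, map_sub, map_pow, sub_eq_zero, map_ofNat, hN, Int.natAbs_natCast]
  set a := π.re
  set b := π.im
  have hab : a ^ 2 + b ^ 2 = p := by rw [← hN, norm_eq]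
  obtain ⟨m, hm⟩ : ∃ m, p = 4 * m + 1 := ⟨p / 4, by omega⟩
  have hm1 : (p - 1) / 4 = m := by omega
  have hm2 : p / 2 = 2 * m := by omega
  have hI : (φ imUnit) ^ 2 = -1 := by rw [← map_pow, imUnit_sq, map_neg, map_one]
  have hzero : (a : ZMod p) + b * φ imUnit = 0 := by
    have h1 := (hφ π).mpr dvd_rfl
    rwa [eq_re_add_im π, map_add, map_mul, map_intCast, map_intCast] at h1
  have hb : (b : ZMod p) = a * φ imUnit := by linear_combination -(φ imUnit) * hzero + b * hI
  have h1 : (a : ZMod p) ^ (2 * m) = 1 := by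
    rw [← hm2, ← legendreSym.eq_pow, legendreSym_sum_two_squares hp4 hab hre, Int.cast_one]
  have h2 : ((a + b : ℤ) : ZMod p) ^ (2 * m) = φ (iPow (a * b / 2 + m)) := by
    rw [← hm2, ← legendreSym.eq_pow, legendreSym_sum_two_squares_add hp4 hab hre him,
      ← chi_eight_exponent hre him (by rw [hab, hm]; push_cast; rfl), map_intCast]
  have h3 : ((a + b : ℤ) : ZMod p) ^ 2 = 2 * φ imUnit * a ^ 2 := by
    push_cast; rw [hb]; linear_combination a ^ 2 * hI
  rw [pow_mul, h3, mul_pow, mul_pow, ← pow_mul, h1, mul_one, iPow_add, map_mul, iPow_natCast,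
    map_pow] at h2
  rw [hm1]
  exact mul_right_cancel₀ (pow_ne_zero _ fun h0 => by simp [h0] at hI) h2

lemma eq_or_eq_neg_of_associated_natCast {π : GaussianInt} {p : ℕ} (hp : Odd p)
    (h : Associated π (p : GaussianInt)) (him : Even π.im) :
    π = (p : GaussianInt) ∨ π = -(p : GaussianInt) := by
  obtain ⟨u, hu⟩ := h.symm
  rw [← hu] at him ⊢
  rcases pow_four_eq_one_cases (pow_four_of_isUnit u.isUnit) with h | h | h | h <;> rw [h] at him ⊢
  · left; rw [mul_one]
  · exfalso
    simp at him
    exact Nat.not_even_iff_odd.mpr hp him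
  · right; rw [mul_neg_one]
  · exfalso
    simp at him
    exact Nat.not_even_iff_odd.mpr hp him

/-- Write α² = r + 4ei with e = re·im/2 and r ≡ 1 (mod 4). For a product the new e is r e' + r' e ≡
e + e' (mod 4). -/
lemma half_re_mul_im_mul {α β : GaussianInt} (ha : Odd α.norm) (hb : Odd β.norm)
    (ha' : Even α.im) (hb' : Even β.im) :
    α.re * α.im / 2 + β.re * β.im / 2 ≡ (α * β).re * (α * β).im / 2 [ZMOD 4] := by
  have h1 := (odd_iff_of_odd_norm ha).mpr ha'
  have h2 := (odd_iff_of_odd_norm hb).mpr hb'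
  rw [Zsqrtd.re_mul, Zsqrtd.im_mul]
  obtain ⟨a, ha⟩ := h1
  obtain ⟨b, hb⟩ := ha'.two_dvd
  obtain ⟨c, hc⟩ := h2
  obtain ⟨d, hd⟩ := hb'.two_dvd
  rw [ha, hb, hc, hd]
  have e1 : (2 * a + 1) * (2 * b) / 2 = (2 * a + 1) * b :=
    Int.ediv_eq_of_eq_mul_left two_ne_zero (by ring)
  have e2 : (2 * c + 1) * (2 * d) / 2 = (2 * c + 1) * d :=
    Int.ediv_eq_of_eq_mul_left two_ne_zero (by ring)
  have e3 : ((2 * a + 1) * (2 * c + 1) + -1 * (2 * b) * (2 * d)) *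
      ((2 * a + 1) * (2 * d) + 2 * b * (2 * c + 1)) / 2 =
      ((2 * a + 1) * (2 * c + 1) + -1 * (2 * b) * (2 * d)) *
      ((2 * a + 1) * d + b * (2 * c + 1)) :=
    Int.ediv_eq_of_eq_mul_left two_ne_zero (by ring)
  rw [e1, e2, e3, Int.modEq_iff_dvd]
  refine ⟨(2 * c + 1) * d * (a ^ 2 + a - b ^ 2) + (2 * a + 1) * b * (c ^ 2 + c - d ^ 2), by ring⟩

/-- The supplementary law for `2`. -/
lemma quarticJacobi_two {β : GaussianInt} (h : Odd β.norm) (h' : Even β.im) :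
    quarticJacobi 2 β = iPow (β.re * β.im / 2) := by
  refine induction_even_im (P := fun β => quarticJacobi 2 β = iPow (β.re * β.im / 2))
    (fun u hu hi => ?_) (fun π hπ ho hi => ?_) (fun a b ha hb ha' hb' iha ihb => ?_) β h h'
  · rw [quarticJacobi_of_isUnit _ hu]
    rcases pow_four_eq_one_cases (pow_four_of_isUnit hu) with rfl | rfl | rfl | rfl
    · simp
    · exact absurd hi (by decide)
    · simp
    · exact absurd hi (by decide)
  · rcases prime_cases hπ ho with ⟨p, hp, h4, hN⟩ | ⟨p, hp, h3, hass⟩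
    · rw [quarticJacobi_of_prime _ hπ, quarticResidue_two hp h4 hN hi]
    · have hp1 : Odd p := by rw [Nat.odd_iff]; omega
      rw [quarticJacobi_of_associated _ hass]
      have h1 := quarticJacobi_intCast_intCast (n := 2) (m := p) (by exact_mod_cast hp1)
        (Int.isCoprime_two_left.mpr (by exact_mod_cast hp1))
      rw [Int.cast_natCast, Int.cast_ofNat] at h1
      have him : π.im = 0 := by
        rcases eq_or_eq_neg_of_associated_natCast hp1 hass hi with h | h <;> simp [h]
      rw [h1, him, mul_zero, Int.zero_ediv, iPow_zero]
  · rw [quarticJacobi_mul_right _ (ne_zero_of_odd_norm ha) (ne_zero_of_odd_norm hb), iha, ihb,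
      ← iPow_add]
    exact iPow_congr (half_re_mul_im_mul ha hb ha' hb')

/-! ### The quartic character modulo p and its Jacobi sum -/

/-- The quartic character of `ZMod p` attached to a prime of `ℤ[i]` of norm `p`. -/
noncomputable def quarticChar {π : GaussianInt} {p : ℕ} (hp : p.Prime) (hp4 : p % 4 = 1)
    (hN : π.norm = p) : MulChar (ZMod p) GaussianInt :=
  have hdvd : ∀ {m n : ℕ}, (m : ZMod p) = n → π ∣ (m : GaussianInt) - n := fun {m n} h => by
    rw [ZMod.natCast_eq_natCast_iff] at h
    obtain ⟨c, hc⟩ := h.symm.dvd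
    have : (m : GaussianInt) - n = p * c := by
      exact_mod_cast congrArg (Int.cast : ℤ → GaussianInt) hc
    rw [this, natCast_eq_mul_star hN, mul_assoc]
    exact dvd_mul_right _ _
  have : NeZero p := ⟨hp.ne_zero⟩
  { toFun := fun x => quarticJacobi (x.val : GaussianInt) π
    map_one' := by
      rw [quarticJacobi_congr (α' := 1) (odd_of_norm_eq hN hp4)
        (by simpa using hdvd (m := (1 : ZMod p).val) (n := 1) (by simp))]
      exact quarticJacobi_one_left (odd_of_norm_eq hN hp4)
    map_mul' := fun x y => by
      rw [← quarticJacobi_mul_left _ _ (odd_of_norm_eq hN hp4), ← Nat.cast_mul]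
      exact quarticJacobi_congr (odd_of_norm_eq hN hp4) (hdvd (by simp))
    map_nonunit' := fun x hx => by
      have : Fact p.Prime := ⟨hp⟩
      have hx0 : x = 0 := by simpa using hx
      rw [hx0, ZMod.val_zero, quarticJacobi_of_prime _ (prime_of_norm_eq_prime hp hN),
        quarticResidue_eq_zero_iff (prime_of_norm_eq_prime hp hN) (odd_of_norm_eq hN hp4)]
      simp }

section Character

variable {π : GaussianInt} {p : ℕ} (hp : p.Prime) (hp4 : p % 4 = 1) (hN : π.norm = p)

lemma quarticChar_intCast (n : ℤ) : quarticChar hp hp4 hN n = quarticJacobi n π := by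
  have : NeZero p := ⟨hp.ne_zero⟩
  refine quarticJacobi_congr (odd_of_norm_eq hN hp4) ?_
  have h : (((n : ZMod p).val : ℤ) : ZMod p) = n := by simp
  rw [ZMod.intCast_eq_intCast_iff] at h
  obtain ⟨c, hc⟩ := h.symm.dvd
  have : ((n : ZMod p).val : GaussianInt) - n = p * c := by
    exact_mod_cast congrArg (Int.cast : ℤ → GaussianInt) hc
  rw [this, natCast_eq_mul_star hN, mul_assoc]
  exact dvd_mul_right _ _

lemma quarticChar_pow_four : quarticChar hp hp4 hN ^ 4 = 1 := by
  have : Fact p.Prime := ⟨hp⟩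
  ext1 x
  rw [MulChar.pow_apply_coe, MulChar.one_apply_coe]
  exact pow_four_of_isUnit (x.isUnit.map (quarticChar hp hp4 hN))

lemma map_quarticChar {φ : GaussianInt →+* ZMod p} (hφ : ∀ α, φ α = 0 ↔ π ∣ α) (x : ZMod p) :
    φ (quarticChar hp hp4 hN x) = x ^ ((p - 1) / 4) := by
  have : Fact p.Prime := ⟨hp⟩
  have hπ := prime_of_norm_eq_prime hp hN
  have h := dvd_pow_sub_quarticResidue (α := (x.val : GaussianInt)) hπ (odd_of_norm_eq hN hp4)
  rw [← hφ, map_sub, map_pow, map_natCast, ZMod.natCast_val, ZMod.cast_id', id, sub_eq_zero, hN,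
    Int.natAbs_natCast, ← quarticJacobi_of_prime _ hπ] at h
  exact h.symm

/-- At a generator of the units, χ² = 1 would give a generator of order at most (p-1)/2. -/
lemma quarticChar_sq_ne_one : quarticChar hp hp4 hN ^ 2 ≠ 1 := by
  have : Fact p.Prime := ⟨hp⟩
  intro h
  obtain ⟨φ, hφ⟩ := exists_ringHom_zmod hN
  obtain ⟨g, hg⟩ := IsCyclic.exists_generator (α := (ZMod p)ˣ)
  have h1 : (φ (quarticChar hp hp4 hN g)) ^ 2 = 1 := by
    rw [← map_pow, ← MulChar.pow_apply_coe, h, MulChar.one_apply_coe, map_one]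
  rw [map_quarticChar hp hp4 hN hφ, ← pow_mul] at h1
  have h2 : g ^ ((p - 1) / 4 * 2) = 1 := by ext; simpa using h1
  have h3 := orderOf_dvd_of_pow_eq_one h2
  rw [orderOf_eq_card_of_forall_mem_zpowers hg, Nat.card_eq_fintype_card, ZMod.card_units] at h3
  have := Nat.le_of_dvd (by have := hp.two_le; omega) h3
  have := hp.two_le
  omega

lemma quarticChar_ne_one : quarticChar hp hp4 hN ≠ 1 := fun h =>
  quarticChar_sq_ne_one hp hp4 hN (by rw [h, one_pow])

lemma isUnit_quarticChar_apply {x : ZMod p} (hx : x ≠ 0) :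
    IsUnit (quarticChar hp hp4 hN x) := by
  have : Fact p.Prime := ⟨hp⟩
  exact (Ne.isUnit hx).map _

lemma isQuadratic_quarticChar_sq : (quarticChar hp hp4 hN ^ 2).IsQuadratic := by
  have : Fact p.Prime := ⟨hp⟩
  intro x
  by_cases hx : x = 0
  · left; rw [hx, MulChar.map_zero]
  · right
    rw [MulChar.pow_apply' _ two_ne_zero]
    have := pow_four_of_isUnit (isUnit_quarticChar_apply hp hp4 hN hx)
    rw [show 4 = 2 * 2 from rfl, pow_mul] at this
    exact sq_eq_one_iff.mp this

/-- The Jacobi sum `J(χ, χ)` of the quartic character. -/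
noncomputable def quarticJacobiSum [Fact p.Prime] : GaussianInt :=
  jacobiSum (quarticChar hp hp4 hN) (quarticChar hp hp4 hN)

/-- In ℂ the inverse character is the conjugate one, so J(χ,χ) J(χ⁻¹,χ⁻¹) = p is a statement about
the norm. -/
lemma norm_quarticJacobiSum [Fact p.Prime] : (quarticJacobiSum hp hp4 hN).norm = p := by
  set χ := (quarticChar hp hp4 hN).ringHomComp toComplex with hχ
  have hinj := GaussianInt.toComplex_injective
  have h1 : χ ≠ 1 := (MulChar.ringHomComp_ne_one_iff hinj).mpr (quarticChar_ne_one hp hp4 hN)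
  have h2 : χ * χ ≠ 1 := by
    rw [← sq, MulChar.ringHomComp_pow]
    exact (MulChar.ringHomComp_ne_one_iff hinj).mpr (quarticChar_sq_ne_one hp hp4 hN)
  have hchar : ringChar ℂ ≠ ringChar (ZMod p) := by
    rw [ringChar.eq_zero, ZMod.ringChar_zmod_n]; exact hp.ne_zero.symm
  have h := jacobiSum_mul_jacobiSum_inv hchar h1 h1 h2
  have hstar : jacobiSum χ⁻¹ χ⁻¹ = star (jacobiSum χ χ) := by
    rw [← MulChar.star_eq_inv]
    simp [jacobiSum, MulChar.star_apply]
  rw [hstar, hχ, jacobiSum_ringHomComp, ZMod.card] at h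
  have h3 : toComplex ((quarticJacobiSum hp hp4 hN).norm : ℤ) = toComplex (p : ℤ) := by
    rw [Zsqrtd.norm_eq_mul_conj, map_mul, GaussianInt.toComplex_star]
    simpa [quarticJacobiSum] using h
  exact_mod_cast hinj h3

/-- Modulo π the summand is x^m (1-x)^m with m = (p-1)/4, a polynomial of degree 2m < p - 1, and the
sums of such powers over `ZMod p` vanish. -/
lemma dvd_quarticJacobiSum [Fact p.Prime] : π ∣ quarticJacobiSum hp hp4 hN := by
  obtain ⟨φ, hφ⟩ := exists_ringHom_zmod hN
  rw [← hφ, quarticJacobiSum, ← jacobiSum_ringHomComp, jacobiSum]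
  simp only [MulChar.ringHomComp_apply, map_quarticChar hp hp4 hN hφ]
  set m := (p - 1) / 4 with hm
  have h2 := hp.two_le
  have e : ∀ x : ZMod p, x ^ m * (1 - x) ^ m =
      ∑ k ∈ Finset.range (m + 1), ((-1) ^ k * (m.choose k : ZMod p)) * x ^ (m + k) := by
    intro x
    rw [sub_eq_neg_add, add_pow, Finset.mul_sum]
    refine Finset.sum_congr rfl fun k _ => ?_
    rw [neg_pow, one_pow, pow_add]; ring
  simp only [e]
  rw [Finset.sum_comm]
  refine Finset.sum_eq_zero fun k hk => ?_
  rw [← Finset.mul_sum, FiniteField.sum_pow_lt_card_sub_one, mul_zero]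
  rw [Finset.mem_range] at hk
  rw [ZMod.card]
  omega

/-- The involution x ↦ 1 - x pairs equal terms, which cancel modulo 2. Its fixed point 1/2
contributes a value of χ², which is real. -/
lemma even_im_quarticJacobiSum [Fact p.Prime] : Even (quarticJacobiSum hp hp4 hN).im := by
  let f : GaussianInt →+ ZMod 2 :=
    { toFun := fun α => (α.im : ZMod 2)
      map_zero' := by simp
      map_add' := by simp }
  have hf : ∀ α : GaussianInt, f α = 0 ↔ Even α.im := fun α => by
    rw [even_iff_two_dvd]
    exact ZMod.intCast_zmod_eq_zero_iff_dvd α.im 2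
  have h2 : (2 : ZMod p) ≠ 0 := by
    have : ((2 : ℕ) : ZMod p) ≠ 0 := by
      rw [Ne, ZMod.natCast_eq_zero_iff]
      intro h
      have := Nat.le_of_dvd two_pos h
      have := hp.two_le
      omega
    exact_mod_cast this
  rw [← hf, quarticJacobiSum, jacobiSum, map_sum,
    ← Finset.sum_erase_add _ _ (Finset.mem_univ (2⁻¹ : ZMod p))]
  have h0 : f (quarticChar hp hp4 hN 2⁻¹ * quarticChar hp hp4 hN (1 - 2⁻¹)) = 0 := by
    have e : (1 - 2⁻¹ : ZMod p) = 2⁻¹ := by field_simp; norm_num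
    rw [e, hf, ← sq, ← MulChar.pow_apply' _ two_ne_zero]
    rcases isQuadratic_quarticChar_sq hp hp4 hN 2⁻¹ with h | h | h <;> rw [h] <;> decide
  rw [h0, add_zero]
  refine Finset.sum_involution (fun x _ => 1 - x) (fun x _ => ?_) (fun x hx _ h => ?_)
    (fun x hx => ?_) (fun x _ => sub_sub_cancel 1 x)
  · rw [sub_sub_cancel, mul_comm]
    exact CharTwo.add_self_eq_zero _
  · refine Finset.ne_of_mem_erase hx ?_
    exact eq_inv_of_mul_eq_one_left (by linear_combination -h)
  · refine Finset.mem_erase.mpr ⟨fun h => Finset.ne_of_mem_erase hx ?_, Finset.mem_univ _⟩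
    have h3 : x = 1 - 2⁻¹ := by linear_combination -h
    rw [h3]; field_simp; norm_num

/-- Divisibility by π and norm p leave only a unit; the even imaginary part rules out ±i. -/
lemma quarticJacobiSum_eq [Fact p.Prime] (him : Even π.im) :
    quarticJacobiSum hp hp4 hN = π ∨ quarticJacobiSum hp hp4 hN = -π := by
  obtain ⟨u, hu⟩ := dvd_quarticJacobiSum hp hp4 hN
  have hnorm := norm_quarticJacobiSum hp hp4 hN
  rw [hu, Zsqrtd.norm_mul, hN] at hnorm
  have hp0 : (p : ℤ) ≠ 0 := by exact_mod_cast hp.ne_zero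
  have hu1 : u.norm = 1 := by
    apply mul_left_cancel₀ hp0; rw [hnorm, mul_one]
  have hre := (odd_iff_of_odd_norm (odd_of_norm_eq hN hp4)).mpr him
  have himu : Even (π * u).im := hu ▸ even_im_quarticJacobiSum hp hp4 hN
  have hunit := (Zsqrtd.norm_eq_one_iff' (by norm_num) u).mp hu1
  rw [hu]
  rcases pow_four_eq_one_cases (pow_four_of_isUnit hunit) with rfl | rfl | rfl | rfl
  · left; rw [mul_one]
  · exfalso; simp at himu; exact Int.not_even_iff_odd.mpr hre himu
  · right; rw [mul_neg_one]
  · exfalso; simp at himu; exact Int.not_even_iff_odd.mpr hre himu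

end Character

/-! ### Gauss sums of the quartic character in characteristic l -/

section GaussSum

variable {π : GaussianInt} {p : ℕ} (hp : p.Prime) (hp4 : p % 4 = 1)
  (hN : π.norm = p) {F : Type*} [Field F] (f : GaussianInt →+* F)

/-- The reduction of the quartic character in a field. -/
noncomputable def quarticCharMap : MulChar (ZMod p) F := (quarticChar hp hp4 hN).ringHomComp f

/-- χ² takes the value -1, which stays different from 1 when 2 ≠ 0. -/
lemma quarticCharMap_sq_ne_one (h2 : (2 : F) ≠ 0) : quarticCharMap hp hp4 hN f ^ 2 ≠ 1 := by
  intro h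
  obtain ⟨x, hx⟩ := MulChar.ne_one_iff.mp (quarticChar_sq_ne_one hp hp4 hN)
  have h1 : (quarticChar hp hp4 hN ^ 2) x = -1 := by
    rcases isQuadratic_quarticChar_sq hp hp4 hN x with h | h | h
    · exact absurd h (x.isUnit.map (quarticChar hp hp4 hN ^ 2)).ne_zero
    · exact absurd h hx
    · exact h
  have h3 : (quarticCharMap hp hp4 hN f ^ 2) x = f ((quarticChar hp hp4 hN ^ 2) x) := by
    rw [quarticCharMap, MulChar.ringHomComp_pow, MulChar.ringHomComp_apply]
  rw [h, h1, MulChar.one_apply_coe, map_neg, map_one] at h3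
  exact h2 (by linear_combination h3)

lemma quarticCharMap_ne_one (h2 : (2 : F) ≠ 0) : quarticCharMap hp hp4 hN f ≠ 1 := fun h =>
  quarticCharMap_sq_ne_one hp hp4 hN f h2 (by rw [h, one_pow])

lemma quarticCharMap_pow_four : quarticCharMap hp hp4 hN f ^ 4 = 1 := by
  rw [quarticCharMap, MulChar.ringHomComp_pow, quarticChar_pow_four, MulChar.ringHomComp_one]

variable [Fact p.Prime]

/-- G(χ)² = J(χ,χ) G(χ²), where G(χ²)² = p = ππ̄ as χ²(-1) = 1, and J(χ,χ)² = π² whichever sign J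
carries. -/
lemma gaussSum_quarticCharMap_pow_four (h2 : (2 : F) ≠ 0) (him : Even π.im)
    {ψ : AddChar (ZMod p) F} (hψ : ψ.IsPrimitive) :
    gaussSum (quarticCharMap hp hp4 hN f) ψ ^ 4 = f (π ^ 3 * star π) := by
  set χ := quarticCharMap hp hp4 hN f with hχ
  have hne := quarticCharMap_sq_ne_one hp hp4 hN f h2
  have h1 := jacobiSum_mul_nontrivial (χ := χ) (φ := χ) (by rwa [← sq]) ψ
  have hquad : (χ ^ 2).IsQuadratic := by
    rw [hχ, quarticCharMap, MulChar.ringHomComp_pow]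
    exact (isQuadratic_quarticChar_sq hp hp4 hN).comp f
  have h3 := gaussSum_sq hne hquad hψ
  have h4 : (χ ^ 2) (-1) = 1 := by
    rw [MulChar.pow_apply' _ two_ne_zero, ← map_pow, neg_one_sq, map_one]
  have h5 : jacobiSum χ χ = f (quarticJacobiSum hp hp4 hN) := by
    rw [hχ, quarticCharMap, jacobiSum_ringHomComp, quarticJacobiSum]
  have h6 : f (quarticJacobiSum hp hp4 hN) ^ 2 = f π ^ 2 := by
    rcases quarticJacobiSum_eq hp hp4 hN him with h | h <;> rw [h]
    rw [map_neg, neg_sq]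
  have h7 : (p : F) = f π * f (star π) := by
    rw [← map_mul, ← natCast_eq_mul_star hN, map_natCast]
  rw [h4, one_mul, ZMod.card, h7] at h3
  rw [← sq, h5] at h1
  calc gaussSum χ ψ ^ 4 = (gaussSum χ ψ * gaussSum χ ψ) ^ 2 := by ring
    _ = gaussSum (χ ^ 2) ψ ^ 2 * f (quarticJacobiSum hp hp4 hN) ^ 2 := by rw [← h1]; ring
    _ = f (π ^ 3 * star π) := by rw [h3, h6, map_mul, map_pow]; ring

variable {l : ℕ} [Fact l.Prime] [CharP F l]

/-- Frobenius acts termwise, turning χ into χ^l and ψ(x) into ψ(lx); substituting for lx extracts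
the value at l. -/
lemma gaussSum_quarticCharMap_frob (hl : (l : ZMod p) ≠ 0) (ψ : AddChar (ZMod p) F) :
    (quarticCharMap hp hp4 hN f ^ l) l * gaussSum (quarticCharMap hp hp4 hN f) ψ ^ l =
      gaussSum (quarticCharMap hp hp4 hN f ^ l) ψ := by
  have hu : IsUnit (l : ZMod p) := Ne.isUnit hl
  rw [gaussSum_frob, AddChar.pow_mulShift]
  exact gaussSum_mulShift _ ψ hu.unit

/-- Here χ^l = χ, so the nonzero Gauss sum cancels, leaving G^(l-1), a power of G⁴. -/
lemma quarticCharMap_mul_pow_of_mod_four_eq_one (h2 : (2 : F) ≠ 0) (him : Even π.im)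
    {ψ : AddChar (ZMod p) F} (hψ : ψ.IsPrimitive) (hl : (l : ZMod p) ≠ 0) (hpl : (p : F) ≠ 0)
    (hl4 : l % 4 = 1) :
    quarticCharMap hp hp4 hN f l * f (π ^ 3 * star π) ^ ((l - 1) / 4) = 1 := by
  have h := gaussSum_quarticCharMap_frob hp hp4 hN f hl ψ
  have hχ : quarticCharMap hp hp4 hN f ^ l = quarticCharMap hp hp4 hN f := by
    conv_lhs => rw [← Nat.div_add_mod l 4, hl4, pow_add, pow_mul, quarticCharMap_pow_four, one_pow,
      one_mul, pow_one]
  rw [hχ] at h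
  have hg : gaussSum (quarticCharMap hp hp4 hN f) ψ ≠ 0 :=
    gaussSum_ne_zero_of_nontrivial (by rwa [ZMod.card]) (quarticCharMap_ne_one hp hp4 hN f h2) hψ
  rw [← gaussSum_quarticCharMap_pow_four hp hp4 hN f h2 him hψ, ← pow_mul]
  apply mul_right_cancel₀ hg
  have e : l = 4 * ((l - 1) / 4) + 1 := by omega
  rw [one_mul, mul_assoc, ← pow_succ, ← e, h]

/-- Here χ^l = χ⁻¹, so one multiplies by G once more and uses G(χ) G(χ⁻¹) = χ(-1) p. -/
lemma quarticCharMap_mul_pow_of_mod_four_eq_three (h2 : (2 : F) ≠ 0) (him : Even π.im)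
    {ψ : AddChar (ZMod p) F} (hψ : ψ.IsPrimitive) (hl : (l : ZMod p) ≠ 0)
    (hl4 : l % 4 = 3) :
    (quarticCharMap hp hp4 hN f ^ 3) l * f (π ^ 3 * star π) ^ ((l + 1) / 4) =
      quarticCharMap hp hp4 hN f (-1) * p := by
  have h := gaussSum_quarticCharMap_frob hp hp4 hN f hl ψ
  have h4 := quarticCharMap_pow_four hp hp4 hN f
  set χ := quarticCharMap hp hp4 hN f with hχ'
  have hχ : χ ^ l = χ ^ 3 := by
    conv_lhs => rw [← Nat.div_add_mod l 4, hl4, pow_add, pow_mul, h4, one_pow, one_mul]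
  have hinv : χ⁻¹ = χ ^ 3 := inv_eq_of_mul_eq_one_right (by rw [← pow_succ', h4])
  have h5 := gaussSum_mul_gaussSum_eq_card (quarticCharMap_ne_one hp hp4 hN f h2) hψ
  rw [← hχ', hinv, ZMod.card] at h5
  have h6 := mul_gaussSum_inv_eq_gaussSum (χ ^ 3) ψ
  have h7 : (χ ^ 3) (-1) = χ (-1) := by
    rw [MulChar.pow_apply' _ three_ne_zero, ← map_pow]
    norm_num
  rw [h7] at h6
  rw [hχ] at h
  have e : l + 1 = 4 * ((l + 1) / 4) := by omega
  rw [← gaussSum_quarticCharMap_pow_four hp hp4 hN f h2 him hψ, ← pow_mul, ← e, pow_succ (gaussSum _ _)]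
  rw [← hχ', ← mul_assoc, h, ← h6, mul_comm _ (gaussSum χ ψ), mul_left_comm, h5]

end GaussSum

/-! ### Quartic reciprocity between rational integers and ℤ[i] -/

/-- A field containing the residue field of `λ` that has a primitive additive character. -/
lemma exists_residue_field {ϖ : GaussianInt} (hϖ : Prime ϖ) {l : ℕ} (hl : l.Prime)
    (hdvd : ϖ ∣ (l : GaussianInt)) {p : ℕ} (hp : p.Prime) (hne : p ≠ l) :
    ∃ (F : Type) (_ : Field F) (_ : CharP F l) (f : GaussianInt →+* F) (ψ : AddChar (ZMod p) F),
      (∀ α, f α = 0 ↔ ϖ ∣ α) ∧ ψ.IsPrimitive := by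
  have hmax : (Ideal.span {ϖ}).IsMaximal :=
    PrincipalIdealRing.isMaximal_of_irreducible hϖ.irreducible
  let _ : Field (GaussianInt ⧸ Ideal.span {ϖ}) := Ideal.Quotient.field _
  let F₀ := GaussianInt ⧸ Ideal.span {ϖ}
  have hl0 : (l : F₀) = 0 := by
    rw [← map_natCast (Ideal.Quotient.mk (Ideal.span {ϖ})), Ideal.Quotient.eq_zero_iff_mem,
      Ideal.mem_span_singleton]
    exact hdvd
  have hchar : CharP F₀ l := (CharP.charP_iff_prime_eq_zero hl).mpr hl0
  have hp0 : ((⟨p, hp.pos⟩ : ℕ+) : F₀) ≠ 0 := by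
    intro h
    have h1 : ((p : ℕ) : F₀) = 0 := h
    rw [CharP.cast_eq_zero_iff F₀ l] at h1
    exact hne ((Nat.prime_dvd_prime_iff_eq hl hp).mp h1).symm
  -- A primitive ψ needs p-th roots of unity, hence a cyclotomic extension of the residue field.
  -- They exist because p ≠ l.
  let ψ := AddChar.primitiveZModChar ⟨p, hp.pos⟩ F₀ hp0
  refine ⟨CyclotomicField ψ.n F₀, inferInstance,
    charP_of_injective_algebraMap (algebraMap F₀ _).injective l,
    (algebraMap F₀ _).comp (Ideal.Quotient.mk _), ψ.char, fun α => ?_, ψ.prim⟩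
  rw [RingHom.comp_apply, map_eq_zero, Ideal.Quotient.eq_zero_iff_mem, Ideal.mem_span_singleton]

/-- Modulo ϖ the Gauss sum identity reads (l/π)(π³π̄/ϖ) = 1. The symbol of π³ is the inverse of
(π/ϖ), and by conjugation (π̄/ϖ) is the inverse of (π/ϖ̄), so (l/π) = (π/ϖ)(π/ϖ̄). -/
lemma quarticJacobi_natCast_comm_of_mod_four_eq_one {π ϖ : GaussianInt} {p l : ℕ} (hp : p.Prime)
    (hp4 : p % 4 = 1) (hN : π.norm = p) (him : Even π.im) (hl : l.Prime) (hl4 : l % 4 = 1)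
    (hNl : ϖ.norm = l) (hne : p ≠ l) :
    quarticJacobi l π = quarticJacobi π l := by
  have : Fact p.Prime := ⟨hp⟩
  have : Fact l.Prime := ⟨hl⟩
  have hϖ := prime_of_norm_eq_prime hl hNl
  have hϖo := odd_of_norm_eq hNl hl4
  have hdvd : ϖ ∣ (l : GaussianInt) := by rw [natCast_eq_mul_star hNl]; exact dvd_mul_right _ _
  obtain ⟨F, _, _, f, ψ, hf, hψ⟩ := exists_residue_field hϖ hl hdvd hp hne
  have hl0 : (l : ZMod p) ≠ 0 := by
    rw [Ne, ZMod.natCast_eq_zero_iff, Nat.prime_dvd_prime_iff_eq hp hl]; exact hne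
  have hcast : ∀ n : ℕ, n.Prime → n ≠ l → (n : F) ≠ 0 := fun n hn hnl => by
    rw [Ne, CharP.cast_eq_zero_iff F l, Nat.prime_dvd_prime_iff_eq hl hn]; exact hnl.symm
  have h2 : (2 : F) ≠ 0 := by
    exact_mod_cast hcast 2 Nat.prime_two (by omega)
  have h := quarticCharMap_mul_pow_of_mod_four_eq_one hp hp4 hN f h2 him hψ hl0
    (hcast p hp hne) hl4
  have hχl : quarticCharMap hp hp4 hN f l = f (quarticJacobi l π) := by
    rw [quarticCharMap, MulChar.ringHomComp_apply]
    have := quarticChar_intCast hp hp4 hN l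
    rw [Int.cast_natCast, Int.cast_natCast] at this
    rw [this]
  have hπϖ : ¬ ϖ ∣ π ^ 3 * star π := by
    rw [← hf, map_mul, map_pow]
    have := hcast p hp hne
    rw [← map_natCast f, natCast_eq_mul_star hN, map_mul] at this
    exact mul_ne_zero (pow_ne_zero _ (left_ne_zero_of_mul this)) (right_ne_zero_of_mul this)
  have hres : f (quarticResidue (π ^ 3 * star π) ϖ) = f (π ^ 3 * star π) ^ ((l - 1) / 4) := by
    have := dvd_pow_sub_quarticResidue (α := π ^ 3 * star π) hϖ hϖo
    rw [← hf, map_sub, map_pow, hNl, Int.natAbs_natCast, sub_eq_zero] at this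
    exact this.symm
  rw [hχl, ← hres, ← map_mul, ← sub_eq_zero, ← map_one f, ← map_sub, hf] at h
  have hlπ : IsCoprime (l : GaussianInt) π := by
    refine isCoprime_of_not_dvd (prime_of_norm_eq_prime hp hN) fun hd => hne ?_
    have := norm_dvd_norm hd
    rw [hN, Zsqrtd.norm_natCast] at this
    have h' : p ∣ l * l := by exact_mod_cast this
    exact (Nat.prime_dvd_prime_iff_eq hp hl).mp ((or_self_iff).mp (hp.dvd_mul.mp h'))
  have h4 := quarticJacobi_pow_four (odd_of_norm_eq hN hp4) hlπ
  have hR4 := quarticResidue_pow_four hϖ hϖo hπϖ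
  have heq := IsQuarticValue.eq_of_dvd_sub hϖo hϖ.not_isUnit
    (.inr (by rw [mul_pow, h4, hR4, one_mul])) (.inr (one_pow 4)) h
  have hstar : quarticResidue (star π) ϖ = star (quarticResidue π (star ϖ)) := by
    rw [← quarticResidue_star _ (prime_star hϖ) (by rwa [Zsqrtd.norm_conj]), star_star]
  have hπ4 : quarticResidue π ϖ ^ 4 = 1 :=
    quarticResidue_pow_four hϖ hϖo fun hd => hπϖ ((hd.trans (dvd_pow_self π three_ne_zero)).mul_right _)
  have hπ4' : quarticResidue π (star ϖ) ^ 4 = 1 := by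
    refine quarticResidue_pow_four (prime_star hϖ) (by rwa [Zsqrtd.norm_conj]) fun hd => hπϖ ?_
    obtain ⟨c, hc⟩ := hd
    rw [hc, star_mul, star_star]
    exact Dvd.dvd.mul_left (Dvd.dvd.mul_left dvd_rfl _) _
  have hs := mul_star_of_pow_four hπ4'
  rw [quarticResidue_mul _ _ hϖ hϖo, pow_succ, pow_two, quarticResidue_mul _ _ hϖ hϖo,
    quarticResidue_mul _ _ hϖ hϖo, hstar] at heq
  rw [quarticJacobi_natCast_of_norm_eq _ hl hNl]
  generalize quarticJacobi l π = A at *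
  generalize quarticResidue π ϖ = B at *
  generalize quarticResidue π (star ϖ) = C at *
  linear_combination (B * C) * heq - A * C * star C * hπ4 - A * hs

/-- Modulo the inert prime l, π̄ = π^l. After cancelling p = π^(l+1), the power of π left is
(l²-1)/4, the one defining (π/l), so (l/π)³(π/l) = (-1/π). -/
lemma quarticJacobi_neg_natCast_comm_of_mod_four_eq_three {π : GaussianInt} {p l : ℕ} (hp : p.Prime)
    (hp4 : p % 4 = 1) (hN : π.norm = p) (him : Even π.im) (hl : l.Prime) (hl4 : l % 4 = 3) :
    quarticJacobi (-l) π = quarticJacobi π l := by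
  have : Fact p.Prime := ⟨hp⟩
  have : Fact l.Prime := ⟨hl⟩
  have hne : p ≠ l := by omega
  have hϖ := prime_natCast hl hl4
  have hlodd : Odd l := by rw [Nat.odd_iff]; omega
  have hϖo := odd_norm_natCast.mpr hlodd
  obtain ⟨F, _, _, f, ψ, hf, hψ⟩ := exists_residue_field hϖ hl dvd_rfl hp hne
  have hl0 : (l : ZMod p) ≠ 0 := by
    rw [Ne, ZMod.natCast_eq_zero_iff, Nat.prime_dvd_prime_iff_eq hp hl]; exact hne
  have hcast : ∀ n : ℕ, n.Prime → n ≠ l → (n : F) ≠ 0 := fun n hn hnl => by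
    rw [Ne, CharP.cast_eq_zero_iff F l, Nat.prime_dvd_prime_iff_eq hl hn]; exact hnl.symm
  have h2 : (2 : F) ≠ 0 := by
    exact_mod_cast hcast 2 Nat.prime_two (by omega)
  have h := quarticCharMap_mul_pow_of_mod_four_eq_three hp hp4 hN f h2 him hψ hl0 hl4
  have hπ0 := hcast p hp hne
  rw [← map_natCast f, natCast_eq_mul_star hN, map_mul] at hπ0
  have hstar : f (star π) = f π ^ l := by
    rw [← map_pow, eq_comm, ← sub_eq_zero, ← map_sub, hf]
    exact natCast_dvd_pow_sub_star hl hl4 π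
  have hodd := odd_of_norm_eq hN hp4
  have hlπ : IsCoprime (l : GaussianInt) π := by
    refine isCoprime_of_not_dvd (prime_of_norm_eq_prime hp hN) fun hd => hne ?_
    have := norm_dvd_norm hd
    rw [hN, Zsqrtd.norm_natCast] at this
    have h' : p ∣ l * l := by exact_mod_cast this
    exact (Nat.prime_dvd_prime_iff_eq hp hl).mp ((or_self_iff).mp (hp.dvd_mul.mp h'))
  have hχ : ∀ n : ℤ, quarticCharMap hp hp4 hN f n = f (quarticJacobi n π) := fun n => by
    rw [quarticCharMap, MulChar.ringHomComp_apply, quarticChar_intCast]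
  have hχl := hχ l
  have hχ1 := hχ (-1)
  rw [Int.cast_natCast, Int.cast_natCast] at hχl
  rw [Int.cast_neg, Int.cast_one, Int.cast_neg, Int.cast_one] at hχ1
  rw [MulChar.pow_apply' _ three_ne_zero, hχl, hχ1, ← map_natCast f p, natCast_eq_mul_star hN,
    map_mul, map_mul, map_pow, hstar] at h
  obtain ⟨k, hk⟩ : ∃ k, l = 4 * k + 3 := ⟨l / 4, by omega⟩
  have e1 : (l + 1) / 4 = k + 1 := by omega
  have e2 : (l * l - 1) / 4 = (l - 1) * (k + 1) := by
    have h1 : l - 1 = 4 * k + 2 := by omega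
    have h2 : l * l = 4 * ((4 * k + 2) * (k + 1)) + 1 := by rw [hk]; ring
    rw [h1]; omega
  have hfπ := left_ne_zero_of_mul hπ0
  have h' : f (quarticJacobi l π) ^ 3 * f π ^ ((l * l - 1) / 4) = f (quarticJacobi (-1) π) := by
    apply mul_right_cancel₀ (mul_ne_zero hfπ (pow_ne_zero l hfπ))
    rw [← h, mul_assoc, ← pow_succ', ← pow_add, e1, ← pow_add, ← pow_mul, e2]
    congr 2
    have h1 : l - 1 = 4 * k + 2 := by omega
    rw [h1, hk]; ring
  have hres : f (quarticResidue π l) = f π ^ ((l * l - 1) / 4) := by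
    have := dvd_pow_sub_quarticResidue (α := π) hϖ hϖo
    rw [← hf, map_sub, map_pow, Zsqrtd.norm_natCast, Int.natAbs_mul, Int.natAbs_natCast,
      sub_eq_zero] at this
    exact this.symm
  rw [← hres, ← map_pow, ← map_mul, ← sub_eq_zero, ← map_sub, hf] at h'
  have h4 := quarticJacobi_pow_four hodd hlπ
  have hR4 := quarticResidue_pow_four hϖ hϖo ((hf π).not.mp hfπ)
  have hm4 := quarticJacobi_pow_four hodd (isCoprime_one_left (x := π)).neg_left
  have heq := IsQuarticValue.eq_of_dvd_sub hϖo hϖ.not_isUnit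
    (.inr (by rw [mul_pow, ← pow_mul, mul_comm 3 4, pow_mul, h4, hR4, one_pow, one_mul]))
    (.inr hm4) h'
  rw [quarticJacobi_of_prime _ hϖ, neg_eq_neg_one_mul, quarticJacobi_mul_left _ _ hodd, ← heq]
  linear_combination (quarticResidue π l) * h4

/-- Quartic reciprocity between a rational integer and a Gaussian prime. -/
lemma quarticJacobi_chi_four_mul_natCast {π : GaussianInt} (hπ : Prime π) (ho : Odd π.norm)
    (him : Even π.im) (n : ℕ) (hn : Odd n) (hc : IsCoprime (n : GaussianInt) π) :
    quarticJacobi ((ZMod.χ₄ n * n : ℤ) : GaussianInt) π = quarticJacobi π n := by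
  have hχ4 : Odd (ZMod.χ₄ n) := by
    rw [ZMod.χ₄_nat_eq_if_mod_four, if_neg (by rw [Nat.odd_iff] at hn; omega)]
    split_ifs <;> decide
  rcases prime_cases hπ ho with ⟨p, hp, hp4, hN⟩ | ⟨p, hp, hp3, hass⟩
  · induction n using Nat.recOnMul with
    | zero => exact absurd hn (by decide)
    | one =>
      rw [Nat.cast_one, Nat.cast_one, map_one, Nat.cast_one, mul_one, Int.cast_one,
        quarticJacobi_one_left ho, quarticJacobi_of_isUnit _ isUnit_one]
    | prime l hl =>
      have hl4 : l % 4 = 1 ∨ l % 4 = 3 := by rw [Nat.odd_iff] at hn; omega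
      rcases hl4 with hl4 | hl4
      · obtain ⟨ϖ, hϖ⟩ := exists_norm_eq_prime hl hl4
        rw [ZMod.χ₄_nat_one_mod_four hl4, one_mul, Int.cast_natCast]
        refine quarticJacobi_natCast_comm_of_mod_four_eq_one hp hp4 hN him hl hl4 hϖ ?_
        rintro rfl
        refine not_dvd_of_isCoprime hπ hc ?_
        rw [natCast_eq_mul_star hN]
        exact dvd_mul_right _ _
      · rw [ZMod.χ₄_nat_three_mod_four hl4, neg_one_mul, Int.cast_neg, Int.cast_natCast]
        exact quarticJacobi_neg_natCast_comm_of_mod_four_eq_three hp hp4 hN him hl hl4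
    | mul a b iha ihb =>
      obtain ⟨ha, hb⟩ := Nat.odd_mul.mp hn
      rw [Nat.cast_mul, map_mul, Int.odd_mul] at hχ4
      rw [Nat.cast_mul] at hc
      have e : ((ZMod.χ₄ (a * b : ℕ) * (a * b : ℕ) : ℤ) : GaussianInt) =
          ((ZMod.χ₄ a * a : ℤ) : GaussianInt) * ((ZMod.χ₄ b * b : ℤ) : GaussianInt) := by
        rw [Nat.cast_mul, map_mul]; push_cast; ring
      rw [e, quarticJacobi_mul_left _ _ ho, iha ha hc.of_mul_left_left hχ4.1,
        ihb hb hc.of_mul_left_right hχ4.2, Nat.cast_mul, quarticJacobi_mul_right _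
        (ne_zero_of_odd_norm (odd_norm_natCast.mpr ha))
        (ne_zero_of_odd_norm (odd_norm_natCast.mpr hb))]
  -- If π is inert, it is ±p and both symbols are between rational integers, hence 1.
  · have hp1 : Odd p := by rw [Nat.odd_iff]; omega
    have hcop : IsCoprime (n : ℤ) p := by
      rw [Nat.isCoprime_iff_coprime, Nat.coprime_comm, hp.coprime_iff_not_dvd]
      intro hd
      refine not_dvd_of_isCoprime hπ hc (hass.dvd.trans ?_)
      exact_mod_cast Nat.cast_dvd_cast hd
    have hcop' : IsCoprime (ZMod.χ₄ n * n : ℤ) p := by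
      refine IsCoprime.mul_left ?_ hcop
      rw [ZMod.χ₄_nat_eq_if_mod_four, if_neg (by rw [Nat.odd_iff] at hn; omega)]
      split_ifs
      · exact isCoprime_one_left
      · exact isCoprime_one_left.neg_left
    have h1 := quarticJacobi_intCast_intCast (m := p) (by exact_mod_cast hp1) hcop'
    rw [quarticJacobi_of_associated _ hass, ← Int.cast_natCast p, h1]
    have h3 := quarticJacobi_intCast_intCast (m := n) (by exact_mod_cast hn) hcop.symm
    have h4 := quarticJacobi_intCast_intCast (m := n) (by exact_mod_cast hn) hcop.symm.neg_left
    rw [Int.cast_neg] at h4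
    rw [Int.cast_natCast, Int.cast_natCast] at h3 h4
    rcases eq_or_eq_neg_of_associated_natCast hp1 hass him with h | h
    · rw [h, h3]
    · rw [h, h4]

/-- Quartic reciprocity between a rational integer and an element of `ℤ[i]`. -/
theorem quarticJacobi_intCast_comm {n : ℤ} (hn : n ≡ 1 [ZMOD 4]) {α : GaussianInt}
    (ho : Odd α.norm) (him : Even α.im) (hc : IsCoprime (n : GaussianInt) α) :
    quarticJacobi n α = quarticJacobi α n := by
  have hn4 : n % 4 = 1 := hn
  have hodd : Odd n := by rw [Int.odd_iff]; omega
  have hodd' : Odd n.natAbs := Int.natAbs_odd.mpr hodd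
  have habs : ZMod.χ₄ n.natAbs * (n.natAbs : ℤ) = n := by
    rcases Int.natAbs_eq n with h | h
    · rw [ZMod.χ₄_nat_one_mod_four (by omega), one_mul, ← h]
    · rw [ZMod.χ₄_nat_three_mod_four (by omega), neg_one_mul, ← h]
  have hno := odd_norm_intCast.mpr hodd
  revert hc
  refine induction_even_im (P := fun α => IsCoprime (n : GaussianInt) α →
    quarticJacobi n α = quarticJacobi α n) (fun u hu hi _ => ?_) (fun π hπ ho hi hc => ?_)
    (fun a b ha hb ha' hb' iha ihb hc => ?_) α ho him
  · have h1 := quarticJacobi_one_left hno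
    have h2 := quarticJacobi_intCast_intCast hodd (isCoprime_one_left (x := n)).neg_left
    rw [Int.cast_neg, Int.cast_one] at h2
    rw [quarticJacobi_of_isUnit _ hu]
    rcases pow_four_eq_one_cases (pow_four_of_isUnit hu) with rfl | rfl | rfl | rfl
    · exact h1.symm
    · exact absurd hi (by decide)
    · exact h2.symm
    · exact absurd hi (by decide)
  · have hc' : IsCoprime (n.natAbs : GaussianInt) π :=
      isCoprime_of_not_dvd hπ fun hd =>
        not_dvd_of_isCoprime hπ hc (hd.trans (associated_natAbs n).symm.dvd)
    have := quarticJacobi_chi_four_mul_natCast hπ ho hi _ hodd' hc'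
    rwa [habs, ← quarticJacobi_of_associated _ (associated_natAbs n)] at this
  · rw [quarticJacobi_mul_left _ _ hno, quarticJacobi_mul_right _ (ne_zero_of_odd_norm ha)
      (ne_zero_of_odd_norm hb), iha hc.of_mul_right_left, ihb hc.of_mul_right_right]

/-! ### The symbols of x and y at c + di -/

lemma mk_eq (a b : ℤ) : (⟨a, b⟩ : GaussianInt) = (a : GaussianInt) + b * imUnit := by
  ext <;> simp

lemma map_iPow {K : Type*} [Field K] (f : GaussianInt →+* K) (e : ℤ) :
    f (iPow e) = f imUnit ^ e := by
  have h : f (iPow e) = ((Units.map (f : GaussianInt →* K) isUnit_imUnit.unit ^ e : Kˣ) : K) := by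
    rw [← map_zpow]; rfl
  rw [h, Units.val_zpow_eq_zpow_val]; rfl

lemma isCoprime_intCast {m n : ℤ} (h : IsCoprime m n) :
    IsCoprime (m : GaussianInt) (n : GaussianInt) := h.map (Int.castRingHom GaussianInt)

lemma isCoprime_of_norm {n : ℤ} {α : GaussianInt} (h : IsCoprime n α.norm) :
    IsCoprime (n : GaussianInt) α := by
  have := isCoprime_intCast h
  rw [Zsqrtd.norm_eq_mul_conj] at this
  exact this.of_mul_right_left

lemma isCoprime_mk_left {a b : ℤ} (h : IsCoprime a b) :
    IsCoprime (a : GaussianInt) (⟨a, b⟩ : GaussianInt) := by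
  apply isCoprime_of_norm
  rw [norm_eq]
  have : IsCoprime a (b ^ 2 + a * a) := (h.pow_right (n := 2)).add_mul_left_right a
  convert this using 1; ring

lemma odd_norm_mk {a b : ℤ} (ha : Odd a) (hb : Even b) : Odd (⟨a, b⟩ : GaussianInt).norm := by
  rw [norm_eq]
  exact ha.pow.add_even (hb.pow_of_ne_zero two_ne_zero)

/-- An odd square is 1 modulo 8, so a contributes only an even amount to the exponent of (i/(a +
2bi)). -/
lemma norm_mk_sub_one_div_four {a b : ℤ} (ha : Odd a) :
    ∃ A, a ^ 2 = 8 * A + 1 ∧ ((⟨a, 2 * b⟩ : GaussianInt).norm - 1) / 4 = 2 * A + b ^ 2 := by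
  obtain ⟨k, hk⟩ := ha
  obtain ⟨A, hA⟩ := Int.even_mul_succ_self k
  have h1 : a ^ 2 = 8 * A + 1 := by rw [hk]; linear_combination 4 * hA
  refine ⟨A, h1, ?_⟩
  rw [norm_eq]
  dsimp only
  rw [h1]
  apply Int.ediv_eq_of_eq_mul_left (by norm_num)
  ring

lemma quarticJacobi_neg_one_mk {a b : ℤ} (ha : Odd a) :
    quarticJacobi (-1) (⟨a, 2 * b⟩ : GaussianInt) = iPow (2 * b) := by
  obtain ⟨A, hA, hN⟩ := norm_mk_sub_one_div_four (b := b) ha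
  rw [← iPow_two, quarticJacobi_iPow _ (odd_norm_mk ha (even_two_mul b)), hN]
  apply iPow_congr
  obtain ⟨B, hB⟩ := Int.even_mul_pred_self b
  rw [Int.modEq_iff_dvd]
  exact ⟨-A - B, by linear_combination -2 * hB⟩

lemma quarticJacobi_two_mk {a b : ℤ} (ha : a ≡ 1 [ZMOD 4]) :
    quarticJacobi 2 (⟨a, 2 * b⟩ : GaussianInt) = iPow b := by
  have ha' : Odd a := by rw [Int.odd_iff]; have : a % 4 = 1 := ha; omega
  rw [quarticJacobi_two (odd_norm_mk ha' (even_two_mul b)) (even_two_mul b)]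
  apply iPow_congr
  dsimp only
  rw [show a * (2 * b) / 2 = a * b from Int.ediv_eq_of_eq_mul_left two_ne_zero (by ring)]
  simpa using ha.mul_right b

/-- The symbol of the imaginary part, for an element with coprime coordinates. -/
lemma quarticJacobi_im {a b : ℤ} (ha : a ≡ 1 [ZMOD 4]) (h : IsCoprime a (2 * b)) :
    quarticJacobi ((2 * b : ℤ) : GaussianInt) ⟨a, 2 * b⟩ = iPow (b ^ 2) := by
  have ha' : Odd a := by rw [Int.odd_iff]; have : a % 4 = 1 := ha; omega
  have ho := odd_norm_mk ha' (even_two_mul b)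
  have hao := odd_norm_intCast.mpr ha'
  obtain ⟨A, hA, hN⟩ := norm_mk_sub_one_div_four (b := b) ha'
  -- 2b ≡ ia modulo a + 2bi. Reciprocity then moves to the modulus a, where a + 2bi ≡ 2bi and the
  -- rational 2b has symbol 1.
  have h1 : quarticJacobi ((2 * b : ℤ) : GaussianInt) ⟨a, 2 * b⟩ =
      quarticJacobi (imUnit * a) ⟨a, 2 * b⟩ := by
    apply quarticJacobi_congr ho
    refine ⟨-imUnit, ?_⟩
    rw [mk_eq]
    linear_combination ((2 * b : ℤ) : GaussianInt) * imUnit_mul_self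
  have h2 : quarticJacobi (⟨a, 2 * b⟩ : GaussianInt) (a : GaussianInt) =
      quarticJacobi (imUnit * (2 * b : ℤ)) a := by
    apply quarticJacobi_congr hao
    refine ⟨1, ?_⟩
    rw [mk_eq]; ring
  have h3 : ((a : GaussianInt).norm - 1) / 4 = 2 * A := by
    rw [Zsqrtd.norm_intCast, ← sq, hA]
    apply Int.ediv_eq_of_eq_mul_left (by norm_num); ring
  rw [h1, quarticJacobi_mul_left _ _ ho, quarticJacobi_intCast_comm ha ho (even_two_mul b)
    (isCoprime_mk_left h), h2, quarticJacobi_mul_left _ _ hao,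
    quarticJacobi_intCast_intCast ha' h.symm, mul_one, quarticJacobi_imUnit ho,
    quarticJacobi_imUnit hao, hN, h3, ← iPow_add]
  apply iPow_congr
  rw [Int.modEq_iff_dvd]
  exact ⟨-A, by ring⟩

/-- Reciprocity applies only to n ≡ 1 (mod 4); the sign and the power of 2 are left to the
supplementary laws. -/
lemma exists_eq_sign_mul_two_pow_mul {x : ℤ} (hx : x ≠ 0) :
    ∃ (s : ℕ) (ε n : ℤ), (ε = 1 ∨ ε = -1) ∧ n ≡ 1 [ZMOD 4] ∧ x = ε * 2 ^ s * n := by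
  obtain ⟨s, m, hm, hxm⟩ := Nat.exists_eq_two_pow_mul_odd (Int.natAbs_ne_zero.mpr hx)
  have hm4 : m % 4 = 1 ∨ m % 4 = 3 := by rw [Nat.odd_iff] at hm; omega
  have hx' : x = x.sign * (2 ^ s * m) := by
    conv_lhs => rw [← Int.sign_mul_natAbs x, hxm]
    push_cast; ring
  have hsign : x.sign = 1 ∨ x.sign = -1 := by
    rcases lt_trichotomy x 0 with h | h | h
    · right; exact Int.sign_eq_neg_one_of_neg h
    · exact absurd h hx
    · left; exact Int.sign_eq_one_of_pos h
  rcases hm4 with h | h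
  · exact ⟨s, x.sign, m, hsign, by rw [Int.ModEq]; omega, by linear_combination hx'⟩
  · refine ⟨s, -x.sign, -m, ?_, by rw [Int.ModEq]; omega, by linear_combination hx'⟩
    rcases hsign with h | h <;> rw [h] <;> simp

/-- Comparison of the symbols of an even integer at two elements congruent modulo it. -/
lemma quarticJacobi_shift {c X D : ℤ} (hc : c ≡ 1 [ZMOD 4]) (hX : X ≠ 0)
    (hcop : IsCoprime ((2 * X : ℤ) : GaussianInt) (⟨c, 2 * D⟩ : GaussianInt))
    (hcop' : IsCoprime ((2 * X : ℤ) : GaussianInt) (⟨c, 2 * (X + D)⟩ : GaussianInt)) :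
    quarticJacobi ((2 * X : ℤ) : GaussianInt) ⟨c, 2 * D⟩ =
      quarticJacobi ((2 * X : ℤ) : GaussianInt) ⟨c, 2 * (X + D)⟩ *
        iPow (if X % 2 = 0 then 0 else 3) := by
  have hc' : Odd c := by rw [Int.odd_iff]; have : c % 4 = 1 := hc; omega
  obtain ⟨s, ε, n, hε, hn, hx⟩ := exists_eq_sign_mul_two_pow_mul hX
  have hn' : Odd n := by rw [Int.odd_iff]; have : n % 4 = 1 := hn; omega
  have ho := odd_norm_mk hc' (even_two_mul D)
  have ho' := odd_norm_mk hc' (even_two_mul (X + D))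
  have e : ((2 * X : ℤ) : GaussianInt) = (ε : GaussianInt) * 2 ^ (s + 1) * n := by
    rw [hx]; push_cast; ring
  have hnn : quarticJacobi (n : GaussianInt) ⟨c, 2 * D⟩ =
      quarticJacobi (n : GaussianInt) ⟨c, 2 * (X + D)⟩ := by
    rw [e] at hcop hcop'
    rw [quarticJacobi_intCast_comm hn ho (even_two_mul _) hcop.of_mul_left_right,
      quarticJacobi_intCast_comm hn ho' (even_two_mul _) hcop'.of_mul_left_right]
    apply quarticJacobi_congr (odd_norm_intCast.mpr hn')
    refine ⟨-(imUnit * 2 ^ (s + 1) * ε), ?_⟩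
    rw [mk_eq, mk_eq]
    have : ((2 * (X + D) : ℤ) : GaussianInt) = (ε : GaussianInt) * 2 ^ (s + 1) * n + (2 * D : ℤ) := by
      rw [← e]; push_cast; ring
    rw [this]; ring
  have hn4 : n % 4 = 1 := hn
  -- Passing from D to X + D changes the exponent of i by (1-ε)X for the sign and (s+1)X for the
  -- powers of 2. The total is 0 modulo 4 for even X and 1 for odd X, whence the correction 3.
  have hXs : (1 - ε) * X + ((s : ℤ) + 1) * X + (if X % 2 = 0 then 0 else 3) ≡ 0 [ZMOD 4] := by
    rw [Int.modEq_zero_iff_dvd]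
    rcases s with _ | _ | s
    · rcases hε with rfl | rfl <;> rw [if_neg (by omega)] <;> omega
    · rw [if_pos (by rcases hε with rfl | rfl <;> omega)]
      rcases hε with rfl | rfl <;> omega
    · rw [if_pos (by rw [hx]; exact Int.emod_eq_zero_of_dvd ⟨ε * 2 ^ (s + 1) * n, by ring⟩), hx]
      exact ⟨((1 - ε) + ((s + 1 + 1 : ℕ) : ℤ) + 1) * (ε * 2 ^ s * n), by ring⟩
  rw [e]
  simp only [quarticJacobi_mul_left _ _ ho, quarticJacobi_mul_left _ _ ho',
    quarticJacobi_pow_left _ _ ho, quarticJacobi_pow_left _ _ ho', quarticJacobi_two_mk hc, hnn,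
    iPow_pow]
  rcases hε with rfl | rfl
  · have key : iPow (D * (s + 1 : ℕ)) = iPow ((X + D) * (s + 1 : ℕ)) *
        iPow (if X % 2 = 0 then 0 else 3) := by
      rw [← iPow_add]
      apply iPow_congr
      have := hXs.add_right (D * (s + 1))
      push_cast
      convert this.symm using 1 <;> ring
    rw [Int.cast_one, quarticJacobi_one_left ho, quarticJacobi_one_left ho', key]
    ring
  · have key : iPow (2 * D) * iPow (D * (s + 1 : ℕ)) = iPow (2 * (X + D)) *
        iPow ((X + D) * (s + 1 : ℕ)) * iPow (if X % 2 = 0 then 0 else 3) := by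
      rw [← iPow_add, ← iPow_add, ← iPow_add]
      apply iPow_congr
      have := hXs.add_right (2 * D + D * (s + 1))
      push_cast
      convert this.symm using 1 <;> ring
    rw [Int.cast_neg, Int.cast_one, quarticJacobi_neg_one_mk hc', quarticJacobi_neg_one_mk hc',
      key]
    ring

/-- The quartic symbols of `x` and `y` for a prime `p = c² + d² = x² + q y²`. -/
lemma quarticJacobi_x_eq {p : ℕ} {q c D X y : ℤ} (hq : q ≡ 1 [ZMOD 4])
    (hcd : (p : ℤ) = c ^ 2 + (2 * D) ^ 2) (hxy : (p : ℤ) = (2 * X) ^ 2 + q * y ^ 2)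
    (hc : c ≡ 1 [ZMOD 4]) (hcop : IsCoprime c (2 * (X + D))) (hy : y ≡ 1 [ZMOD 4])
    (hX : X ≠ 0) (hpx : IsCoprime (2 * X) (p : ℤ)) (hpy : IsCoprime y (p : ℤ))
    (hdq : IsCoprime (2 * (X + D)) (q * y ^ 2)) (hxq : IsCoprime (2 * X) (q * y ^ 2)) :
    quarticJacobi ((2 * X : ℤ) : GaussianInt) ⟨c, 2 * D⟩ =
      quarticJacobi ⟨c, 2 * (X + D)⟩ q * quarticJacobi (y : GaussianInt) ⟨c, 2 * D⟩ *
        iPow (2 * ((y ^ 2 - 1) / 8) + (X + D) - (X + D) ^ 2 + if X % 2 = 0 then 0 else 3) := by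
  have hc' : Odd c := by rw [Int.odd_iff]; have : c % 4 = 1 := hc; omega
  have hy' : Odd y := by rw [Int.odd_iff]; have : y % 4 = 1 := hy; omega
  have ho := odd_norm_mk hc' (even_two_mul D)
  have ho' := odd_norm_mk hc' (even_two_mul (X + D))
  have hyo := odd_norm_intCast.mpr hy'
  have hN : (⟨c, 2 * D⟩ : GaussianInt).norm = p := by rw [norm_eq, hcd]
  have hN' : (⟨c, 2 * (X + D)⟩ : GaussianInt).norm =
      2 * (2 * X) * (2 * (X + D)) + q * y ^ 2 := by
    rw [norm_eq]; dsimp only; linear_combination hxy - hcd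
  have hNR := congrArg (Int.cast : ℤ → GaussianInt) hN'
  rw [Zsqrtd.norm_eq_mul_conj] at hNR
  have h2q : IsCoprime (2 * (2 * X) * (2 * (X + D))) (q * y ^ 2) := by
    refine IsCoprime.mul_left (IsCoprime.mul_left ?_ hxq) hdq
    exact hxq.of_mul_left_left
  have hqyN : IsCoprime (q * y ^ 2) (⟨c, 2 * (X + D)⟩ : GaussianInt).norm := by
    rw [hN']
    have := h2q.symm.add_mul_left_right 1
    rwa [mul_one] at this
  have hqρ : IsCoprime (q : GaussianInt) ⟨c, 2 * (X + D)⟩ :=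
    isCoprime_of_norm hqyN.of_mul_left_left
  have hyρ : IsCoprime (y : GaussianInt) ⟨c, 2 * (X + D)⟩ :=
    isCoprime_of_norm (hqyN.of_mul_left_right.of_isCoprime_of_dvd_left (dvd_pow_self y two_ne_zero))
  have hyπ : IsCoprime (y : GaussianInt) ⟨c, 2 * D⟩ := isCoprime_of_norm (by rwa [hN])
  have hxπ : IsCoprime ((2 * X : ℤ) : GaussianInt) ⟨c, 2 * D⟩ := isCoprime_of_norm (by rwa [hN])
  have hxρ : IsCoprime ((2 * X : ℤ) : GaussianInt) ⟨c, 2 * (X + D)⟩ := by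
    have e : (⟨c, 2 * (X + D)⟩ : GaussianInt) = ⟨c, 2 * D⟩ + (2 * X : ℤ) * imUnit := by
      rw [mk_eq, mk_eq]; push_cast; ring
    rw [e]
    exact hxπ.add_mul_left_right imUnit
  -- the symbol of `y`
  have hysq : quarticJacobi (y : GaussianInt) ⟨c, 2 * (X + D)⟩ ^ 2 =
      iPow (2 * ((y ^ 2 - 1) / 8)) * quarticJacobi (y : GaussianInt) ⟨c, 2 * D⟩ := by
    rw [quarticJacobi_intCast_comm hy ho' (even_two_mul _) hyρ,
      quarticJacobi_intCast_comm hy ho (even_two_mul _) hyπ, ← quarticJacobi_pow_left _ _ hyo]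
    -- With ρ = c + (x+d)i and π = c + di, ρ² - 2(x+d)iπ = c² + d² - x² = qy².
    have h1 : quarticJacobi ((⟨c, 2 * (X + D)⟩ : GaussianInt) ^ 2) y =
        quarticJacobi (((2 * (2 * (X + D)) : ℤ) : GaussianInt) * imUnit * ⟨c, 2 * D⟩) y := by
      apply quarticJacobi_congr hyo
      refine ⟨(q * y : ℤ), ?_⟩
      have h2 : ((c ^ 2 + (2 * D) ^ 2 : ℤ) : GaussianInt) = ((2 * X) ^ 2 + q * y ^ 2 : ℤ) := by
        rw [← hcd, ← hxy]
      push_cast at h2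
      rw [mk_eq, mk_eq]
      push_cast
      linear_combination h2 + ((2 * (X + D)) ^ 2 - 2 * (2 * (X + D)) * (2 * D)) * imUnit_mul_self
    have h3 : IsCoprime (2 * (2 * (X + D))) y := by
      refine IsCoprime.mul_left (Int.isCoprime_two_left.mpr hy') ?_
      exact (hdq.of_mul_right_right).of_isCoprime_of_dvd_right (dvd_pow_self y two_ne_zero)
    have h4 : ((y : GaussianInt).norm - 1) / 4 = 2 * ((y ^ 2 - 1) / 8) := by
      obtain ⟨A, hA, -⟩ := norm_mk_sub_one_div_four (b := 0) hy'
      rw [Zsqrtd.norm_intCast, ← sq, hA]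
      omega
    rw [h1, quarticJacobi_mul_left _ _ hyo, quarticJacobi_mul_left _ _ hyo,
      quarticJacobi_intCast_intCast hy' h3, one_mul, quarticJacobi_imUnit hyo, h4]
  -- the relation modulo `⟨c, 2 * (X + D)⟩`
  have hrel : quarticJacobi ((-1) * 2 * (2 * X : ℤ) * (2 * (X + D) : ℤ)) ⟨c, 2 * (X + D)⟩ =
      quarticJacobi ((q : GaussianInt) * (y : GaussianInt) ^ 2) ⟨c, 2 * (X + D)⟩ := by
    apply quarticJacobi_congr ho'
    refine ⟨-star (⟨c, 2 * (X + D)⟩ : GaussianInt), ?_⟩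
    rw [mul_neg, hNR]; push_cast; ring
  simp only [quarticJacobi_mul_left _ _ ho', quarticJacobi_pow_left _ _ ho',
    quarticJacobi_neg_one_mk hc', quarticJacobi_two_mk hc, quarticJacobi_im hc hcop, hysq,
    quarticJacobi_intCast_comm hq ho' (even_two_mul _) hqρ] at hrel
  rw [quarticJacobi_shift hc hX hxπ hxρ]
  generalize quarticJacobi ((2 * X : ℤ) : GaussianInt) ⟨c, 2 * (X + D)⟩ = A at *
  generalize quarticJacobi (y : GaussianInt) ⟨c, 2 * D⟩ = B at *
  generalize quarticJacobi (⟨c, 2 * (X + D)⟩ : GaussianInt) q = C at *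
  generalize 2 * ((y ^ 2 - 1) / 8) = Y at *
  generalize X + D = u at *
  -- The first three factors are the symbols at ρ of -1, 2 and x + d; the last is their inverse, as
  -- the exponents add up to 4u.
  have h1 : iPow (2 * u) * iPow u * iPow (u ^ 2) * iPow (u - u ^ 2) = 1 := by
    rw [← iPow_add, ← iPow_add, ← iPow_add, ← iPow_four_mul u]
    congr 1; ring
  rw [iPow_add, show Y + u - u ^ 2 = Y + (u - u ^ 2) by ring, iPow_add]
  set E := iPow (if X % 2 = 0 then 0 else 3)
  linear_combination E * iPow (u - u ^ 2) * hrel - E * A * h1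

/-! ### The symbol of a fraction -/

/-- The defining congruence of the residue of a fraction. -/
lemma ratResidue_mul_modEq {a b q : ℤ} (h : IsCoprime b q) :
    q ∣ ratResidue ((a : ℚ) / (b : ℚ)) q * b - a := by
  -- For b = 0, coprimality makes q a unit, so any residue will do.
  by_cases hb : b = 0
  · rw [hb, isCoprime_zero_left] at h
    exact h.dvd
  set r : ℚ := (a : ℚ) / (b : ℚ) with hr
  have hdvd : (r.den : ℤ) ∣ b := by
    rw [hr, ← Rat.divInt_eq_div]; exact Rat.den_dvd a b
  have hcop : IsCoprime (r.den : ℤ) q := h.of_isCoprime_of_dvd_left hdvd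
  have hcross : r.num * b = a * r.den := by
    have h1 : (r.num : ℚ) / r.den = a / b := by rw [Rat.num_div_den, hr]
    have hb' : (b : ℚ) ≠ 0 := by exact_mod_cast hb
    have hd' : (r.den : ℚ) ≠ 0 := by exact_mod_cast r.den_nz
    rw [div_eq_div_iff hd' hb'] at h1
    exact_mod_cast h1
  have ht : q ∣ ratResidue r q * r.den - r.num := by
    rw [← Int.natAbs_dvd, ← ZMod.intCast_zmod_eq_zero_iff_dvd]
    have hc : Nat.Coprime r.den q.natAbs := by
      have := isCoprime_natAbs_right hcop
      exact Nat.isCoprime_iff_coprime.mp this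
    unfold ratResidue
    push_cast
    rw [mul_assoc, mul_comm _ (r.den : ZMod q.natAbs),
      ZMod.coe_mul_inv_eq_one _ hc, mul_one, sub_self]
  have : q ∣ (ratResidue r q * b - a) * r.den := by
    have e : (ratResidue r q * b - a) * r.den = (ratResidue r q * r.den - r.num) * b := by
      linear_combination hcross
    rw [e]; exact ht.mul_right b
  exact hcop.symm.dvd_of_dvd_mul_right this

/-- With t the residue of a/b, b(t + i) ≡ a + bi (mod q), and the rational b has symbol 1. -/
lemma quarticSymbolRatAddI_eq {a b q : ℤ} (hq : Odd q) (h : IsCoprime b q) :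
    quarticSymbolRatAddI ((a : ℚ) / (b : ℚ)) q = toComplex (quarticJacobi ⟨a, b⟩ q) := by
  have hqo := odd_norm_intCast.mpr hq
  have h1 : quarticJacobi (⟨a, b⟩ : GaussianInt) q =
      quarticJacobi ((b : GaussianInt) * ⟨ratResidue ((a : ℚ) / (b : ℚ)) q, 1⟩) q := by
    apply quarticJacobi_congr hqo
    obtain ⟨k, hk⟩ := ratResidue_mul_modEq (a := a) h
    refine ⟨-(k : GaussianInt), ?_⟩
    have hk' := congrArg (Int.cast : ℤ → GaussianInt) hk
    push_cast at hk'
    rw [mk_eq, mk_eq]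
    push_cast
    linear_combination -hk'
  rw [h1, quarticJacobi_mul_left _ _ hqo, quarticJacobi_intCast_intCast hq h, one_mul,
    toComplex_quarticJacobi, quarticSymbolRatAddI]

/-! ### Exponents of i and passage to residues modulo p -/

/-- The exponents of `i` that occur in the four cases. -/
lemma exponent_modEq {p q c D X y N : ℤ} (hc : Odd c) (hy : Odd y)
    (hcd : p = c ^ 2 + (2 * D) ^ 2) (hxy : p = (2 * X) ^ 2 + q * y ^ 2) :
    (p = 8 * N + 1 →
      (q % 8 = 1 → 2 * N + (2 * ((y ^ 2 - 1) / 8) + (X + D) - (X + D) ^ 2 +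
          if X % 2 = 0 then 0 else 3) ≡
        2 * ((q - 1) / 8 + 2 * D / 4 + 2 * X / 4) [ZMOD 4]) ∧
      (q % 8 = 5 → 2 * N + (2 * ((y ^ 2 - 1) / 8) + (X + D) - (X + D) ^ 2 +
          if X % 2 = 0 then 0 else 3) ≡
        2 * ((q - 5) / 8 + 2 * D / 4 + (2 * X - 2) / 4) + 1 [ZMOD 4])) ∧
    (p = 8 * N + 5 → (D % 2 = 1 → D % 4 = 1) →
      (q % 8 = 1 → 2 * N + (2 * ((y ^ 2 - 1) / 8) + (X + D) - (X + D) ^ 2 +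
          if X % 2 = 0 then 0 else 3) ≡
        2 * ((q - 1) / 8 + (2 * X - 2) / 4) + 1 [ZMOD 4]) ∧
      (q % 8 = 5 → 2 * N + (2 * ((y ^ 2 - 1) / 8) + (X + D) - (X + D) ^ 2 +
          if X % 2 = 0 then 0 else 3) ≡
        2 * ((q - 5) / 8 + 2 * X / 4) [ZMOD 4])) := by
  obtain ⟨C, hC, -⟩ := norm_mk_sub_one_div_four (b := 0) hc
  obtain ⟨Y, hY, -⟩ := norm_mk_sub_one_div_four (b := 0) hy
  have hY' : (y ^ 2 - 1) / 8 = Y := by omega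
  rw [hC] at hcd
  rw [hY] at hxy
  rw [hY']
  have hparity : ∀ z : ℤ, (z % 2 = 0 ∧ ∃ w, z = 2 * w ∧ z ^ 2 = 4 * w ^ 2) ∨
      (z % 2 = 1 ∧ ∃ w, z = 2 * w + 1 ∧ z ^ 2 = 4 * (w ^ 2 + w) + 1) := by
    intro z
    rcases Int.even_or_odd' z with ⟨w, h | h⟩
    · exact .inl ⟨by omega, w, h, by rw [h]; ring⟩
    · exact .inr ⟨by omega, w, h, by rw [h]; ring⟩
  have hD2 : (2 * D) ^ 2 = 4 * D ^ 2 := by ring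
  have hX2 : (2 * X) ^ 2 = 4 * X ^ 2 := by ring
  rw [hD2] at hcd
  rw [hX2] at hxy
  refine ⟨fun hN => ⟨fun hq => ?_, fun hq => ?_⟩, fun hN hD4 => ⟨fun hq => ?_, fun hq => ?_⟩⟩
  · obtain ⟨r, rfl⟩ : ∃ r, q = 8 * r + 1 := ⟨q / 8, by omega⟩
    have e : (8 * r + 1) * (8 * Y + 1) = 8 * (8 * (r * Y) + r + Y) + 1 := by ring
    rw [e] at hxy
    -- The residues of p and q modulo 8 fix the parities of D and X; the other parities are
    -- contradictory.
    rcases hparity D with ⟨-, D', rfl, hDD⟩ | ⟨-, D', -, hDD⟩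
    swap; · omega
    rcases hparity X with ⟨hXm, X', rfl, hXX⟩ | ⟨-, X', -, hXX⟩
    swap; · omega
    have e1 : (8 * r + 1 - 1) / 8 = r := by omega
    have e2 : 2 * (2 * D') / 4 = D' := by omega
    have e3 : 2 * (2 * X') / 4 = X' := by omega
    have hN' : N = 2 * X' ^ 2 + 8 * (r * Y) + r + Y := by omega
    rw [if_pos hXm, e1, e2, e3, hN', Int.modEq_iff_dvd]
    exact ⟨-X' ^ 2 - 4 * r * Y - Y + (X' + D') ^ 2, by ring⟩
  · obtain ⟨r, rfl⟩ : ∃ r, q = 8 * r + 5 := ⟨q / 8, by omega⟩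
    have e : (8 * r + 5) * (8 * Y + 1) = 8 * (8 * (r * Y) + r + 5 * Y) + 5 := by ring
    rw [e] at hxy
    rcases hparity D with ⟨-, D', rfl, hDD⟩ | ⟨-, D', -, hDD⟩
    swap; · omega
    rcases hparity X with ⟨-, X', -, hXX⟩ | ⟨hXm, X', rfl, hXX⟩
    · omega
    have e1 : (8 * r + 5 - 5) / 8 = r := by omega
    have e2 : 2 * (2 * D') / 4 = D' := by omega
    have e3 : (2 * (2 * X' + 1) - 2) / 4 = X' := by omega
    have hN' : N = 2 * (X' ^ 2 + X') + 8 * (r * Y) + r + 5 * Y + 1 := by omega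
    rw [if_neg (by omega), e1, e2, e3, hN', Int.modEq_iff_dvd]
    exact ⟨X' + D' - X' ^ 2 - X' - 4 * r * Y - 3 * Y - 1 + (X' + D') ^ 2, by ring⟩
  · obtain ⟨r, rfl⟩ : ∃ r, q = 8 * r + 1 := ⟨q / 8, by omega⟩
    have e : (8 * r + 1) * (8 * Y + 1) = 8 * (8 * (r * Y) + r + Y) + 1 := by ring
    rw [e] at hxy
    rcases hparity D with ⟨-, D', -, hDD⟩ | ⟨hDm, D', rfl, hDD⟩
    · omega
    rcases hparity X with ⟨-, X', -, hXX⟩ | ⟨hXm, X', rfl, hXX⟩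
    · omega
    -- Here D ≡ 1 (mod 4) is essential: the sign of d enters the exponent when D is odd.
    obtain ⟨D'', rfl⟩ : ∃ w, D' = 2 * w := ⟨D' / 2, by have := hD4 hDm; omega⟩
    have e1 : (8 * r + 1 - 1) / 8 = r := by omega
    have e3 : (2 * (2 * X' + 1) - 2) / 4 = X' := by omega
    have hN' : N = 2 * (X' ^ 2 + X') + 8 * (r * Y) + r + Y := by omega
    rw [if_neg (by omega), e1, e3, hN', Int.modEq_iff_dvd]
    exact ⟨-1 - X' ^ 2 - X' - 4 * r * Y - Y - D'' + (X' + 2 * D'' + 1) ^ 2, by ring⟩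
  · obtain ⟨r, rfl⟩ : ∃ r, q = 8 * r + 5 := ⟨q / 8, by omega⟩
    have e : (8 * r + 5) * (8 * Y + 1) = 8 * (8 * (r * Y) + r + 5 * Y) + 5 := by ring
    rw [e] at hxy
    rcases hparity D with ⟨-, D', -, hDD⟩ | ⟨hDm, D', rfl, hDD⟩
    · omega
    rcases hparity X with ⟨hXm, X', rfl, hXX⟩ | ⟨-, X', -, hXX⟩
    swap; · omega
    obtain ⟨D'', rfl⟩ : ∃ w, D' = 2 * w := ⟨D' / 2, by have := hD4 hDm; omega⟩
    have e1 : (8 * r + 5 - 5) / 8 = r := by omega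
    have e3 : 2 * (2 * X') / 4 = X' := by omega
    have hN' : N = 2 * X' ^ 2 + 8 * (r * Y) + r + 5 * Y := by omega
    rw [if_pos hXm, e1, e3, hN', Int.modEq_iff_dvd]
    exact ⟨X' + D'' - X' ^ 2 - 4 * r * Y - 3 * Y + (X' + 2 * D'') ^ 2, by ring⟩

lemma zpow_congr_of_sq_eq_neg_one {K : Type*} [Field K] {f : K} (hf : f ^ 2 = -1) {m n : ℤ}
    (h : m ≡ n [ZMOD 4]) : f ^ m = f ^ n := by
  have hf0 : f ≠ 0 := by rintro rfl; simp at hf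
  obtain ⟨k, hk⟩ := h.dvd
  have h4 : f ^ (4 : ℤ) = 1 := by
    rw [show (4 : ℤ) = ((2 * 2 : ℕ) : ℤ) by norm_num, zpow_natCast, pow_mul, hf, neg_one_sq]
  rw [show n = m + 4 * k by lia, zpow_add₀ hf0, zpow_mul, h4, one_zpow, mul_one]

lemma neg_one_zpow_of_sq_eq_neg_one {K : Type*} [Field K] {f : K} (hf : f ^ 2 = -1) (n : ℤ) :
    (-1 : K) ^ n = f ^ (2 * n) := by
  rw [zpow_mul, ← hf]; norm_cast

/-- The comparison of `x` and `y` modulo `p`. -/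
lemma x_pow_eq {p : ℕ} [Fact p.Prime] (hp : p % 4 = 1) {q c D X y k : ℤ} (hq : q ≡ 1 [ZMOD 4])
    (hcd : (p : ℤ) = c ^ 2 + (2 * D) ^ 2) (hxy : (p : ℤ) = (2 * X) ^ 2 + q * y ^ 2)
    (hc : c ≡ 1 [ZMOD 4]) (hcop : IsCoprime c (2 * (X + D))) (hy : y ≡ 1 [ZMOD 4])
    (hX : X ≠ 0) (hpx : IsCoprime (2 * X) (p : ℤ)) (hpy : IsCoprime y (p : ℤ))
    (hdq : IsCoprime (2 * (X + D)) (q * y ^ 2)) (hxq : IsCoprime (2 * X) (q * y ^ 2))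
    (hk : quarticJacobi ⟨c, 2 * (X + D)⟩ q = iPow k) :
    (((2 * D : ℤ) : ZMod p) / (c : ZMod p)) ^ 2 = -1 ∧
    ((2 * X : ℤ) : ZMod p) ^ ((p - 1) / 4) =
      (((2 * D : ℤ) : ZMod p) / (c : ZMod p)) ^ (k + (2 * ((y ^ 2 - 1) / 8) + (X + D) -
        (X + D) ^ 2 + if X % 2 = 0 then 0 else 3)) * (y : ZMod p) ^ ((p - 1) / 4) := by
  have hP : p.Prime := Fact.out
  have hN : (⟨c, 2 * D⟩ : GaussianInt).norm = p := by rw [norm_eq, hcd]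
  have hπ := prime_of_norm_eq_prime hP hN
  have ho := odd_of_norm_eq hN hp
  obtain ⟨φ, hφ⟩ := exists_ringHom_zmod hN
  have hI : (φ imUnit) ^ 2 = -1 := by rw [← map_pow, imUnit_sq, map_neg, map_one]
  have hzero : (c : ZMod p) + (2 * D : ℤ) * φ imUnit = 0 := by
    have h1 := (hφ ⟨c, 2 * D⟩).mpr dvd_rfl
    rwa [mk_eq, map_add, map_mul, map_intCast, map_intCast] at h1
  -- Multiplying c + d·φ(i) = 0 by φ(i) shows that i reduces to d/c.
  have hd : ((2 * D : ℤ) : ZMod p) = c * φ imUnit := by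
    linear_combination -(φ imUnit) * hzero + ((2 * D : ℤ) : ZMod p) * hI
  have hc0 : (c : ZMod p) ≠ 0 := by
    intro h0
    rw [h0, zero_mul, ZMod.intCast_zmod_eq_zero_iff_dvd] at hd
    rw [ZMod.intCast_zmod_eq_zero_iff_dvd] at h0
    have h1 := isCoprime_of_sq_add_sq_eq_prime hP hcd.symm
    exact (Nat.prime_iff_prime_int.mp hP).not_isUnit (h1.isUnit_of_dvd' h0 hd)
  have hf : ((2 * D : ℤ) : ZMod p) / (c : ZMod p) = φ imUnit := by
    rw [hd]; field_simp
  have hsym : ∀ n : ℤ, φ (quarticJacobi n ⟨c, 2 * D⟩) = (n : ZMod p) ^ ((p - 1) / 4) := by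
    intro n
    rw [quarticJacobi_of_prime _ hπ]
    have := dvd_pow_sub_quarticResidue (α := (n : GaussianInt)) hπ ho
    rw [← hφ, map_sub, map_pow, map_intCast, hN, Int.natAbs_natCast, sub_eq_zero] at this
    exact this.symm
  rw [hf]
  refine ⟨hI, ?_⟩
  have h := congrArg φ (quarticJacobi_x_eq hq hcd hxy hc hcop hy hX hpx hpy hdq hxq)
  rw [hk, map_mul, map_mul, hsym, hsym, mul_right_comm, ← map_mul, ← iPow_add, map_iPow] at h
  exact h

end GaussianInt

/-! ### The theorem -/

open GaussianInt

theorem theorem3p1 (p : ℕ) [Fact p.Prime] (hp : p % 4 = 1)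
    (q c d x y d₀ : ℤ) (r : ℕ)
    (hq : Odd q) (hpq : ¬ (p : ℤ) ∣ q)
    (hcd : (p : ℤ) = c ^ 2 + d ^ 2) (hxy : (p : ℤ) = x ^ 2 + q * y ^ 2)
    (hc : c ≡ 1 [ZMOD 4]) (hd : d = 2 ^ r * d₀) (hd₀ : d₀ ≡ 1 [ZMOD 4])
    (hcop : IsCoprime c (x + d)) (hx : Even x) (hy : y ≡ 1 [ZMOD 4]) :
    -- `q ≡ 1 (mod 4)`, and the symbol makes sense and is a power of `i`
    q ≡ 1 [ZMOD 4] ∧ IsCoprime (x + d) q ∧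
    (∃ k : ℤ, quarticSymbolRatAddI ((c : ℚ) / ((x + d : ℤ) : ℚ)) q = Complex.I ^ k) ∧
    ∀ k : ℤ, quarticSymbolRatAddI ((c : ℚ) / ((x + d : ℤ) : ℚ)) q = Complex.I ^ k →
      (p % 8 = 1 →
        (q ≡ 1 [ZMOD 8] →
          (q : ZMod p) ^ ((p - 1) / 8) =
            (-1) ^ ((q - 1) / 8 + d / 4 + x / 4) * ((d : ZMod p) / (c : ZMod p)) ^ k) ∧
        (q ≡ 5 [ZMOD 8] →
          (q : ZMod p) ^ ((p - 1) / 8) =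
            (-1) ^ ((q - 5) / 8 + d / 4 + (x - 2) / 4) *
              ((d : ZMod p) / (c : ZMod p)) ^ (k + 1))) ∧
      (p % 8 = 5 →
        (q ≡ 1 [ZMOD 8] →
          (q : ZMod p) ^ ((p - 5) / 8) =
            (-1) ^ ((q - 1) / 8 + (x - 2) / 4) *
              ((d : ZMod p) / (c : ZMod p)) ^ (k + 1) * ((y : ZMod p) / (x : ZMod p))) ∧
        (q ≡ 5 [ZMOD 8] →
          (q : ZMod p) ^ ((p - 5) / 8) =
            (-1) ^ ((q - 5) / 8 + x / 4) *
              ((d : ZMod p) / (c : ZMod p)) ^ k * ((y : ZMod p) / (x : ZMod p)))) := by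
  have hP : p.Prime := Fact.out
  have hPint := Nat.prime_iff_prime_int.mp hP
  have hc' : Odd c := by rw [Int.odd_iff]; have : c % 4 = 1 := hc; omega
  have hy' : Odd y := by rw [Int.odd_iff]; have : y % 4 = 1 := hy; omega
  obtain ⟨A, hA, -⟩ := norm_mk_sub_one_div_four (b := 0) hc'
  obtain ⟨Y, hY, -⟩ := norm_mk_sub_one_div_four (b := 0) hy'
  have hp' : (p : ℤ) % 4 = 1 := by omega
  have hdeven : Even d := by
    by_contra h
    obtain ⟨B, hB, -⟩ := norm_mk_sub_one_div_four (b := 0) (Int.not_even_iff_odd.mp h)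
    omega
  obtain ⟨D, rfl⟩ := hdeven.two_dvd
  obtain ⟨X, rfl⟩ := hx.two_dvd
  have hq4 : q ≡ 1 [ZMOD 4] := by
    have e : (p : ℤ) = q + 4 * (X ^ 2 + 2 * q * Y) := by
      linear_combination hxy + q * hY
    rw [Int.ModEq]
    omega
  have hq4' : q % 4 = 1 := hq4
  have hpy : IsCoprime y (p : ℤ) := by
    refine ((hPint.irreducible.coprime_iff_not_dvd).mpr fun h => ?_).symm
    have h1 : (p : ℤ) ∣ 2 * X := by
      refine hPint.dvd_of_dvd_pow (n := 2) ?_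
      rw [show (2 * X) ^ 2 = p - q * y ^ 2 by rw [hxy]; ring]
      exact dvd_sub dvd_rfl ((h.trans (dvd_pow_self y two_ne_zero)).mul_left q)
    have h2 : (p : ℤ) * p ∣ p := by
      conv_rhs => rw [hxy, sq, sq]
      exact dvd_add (mul_dvd_mul h1 h1) ((mul_dvd_mul h h).mul_left q)
    exact hPint.not_isUnit (hPint.irreducible.squarefree _ h2)
  have hpx : IsCoprime (2 * X) (p : ℤ) := by
    refine ((hPint.irreducible.coprime_iff_not_dvd).mpr fun h => ?_).symm
    have h1 : (p : ℤ) ∣ q * y ^ 2 := by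
      rw [show q * y ^ 2 = p - (2 * X) ^ 2 by rw [hxy]; ring]
      exact dvd_sub dvd_rfl (h.trans (dvd_pow_self _ two_ne_zero))
    have h2 := hPint.dvd_of_dvd_pow ((hPint.dvd_or_dvd h1).resolve_left hpq)
    exact hPint.not_isUnit (hpy.isUnit_of_dvd' h2 dvd_rfl)
  have hxq : IsCoprime (2 * X) (q * y ^ 2) := by
    rw [hxy, sq (2 * X), add_comm] at hpx
    exact hpx.of_add_mul_left_right
  have hX : X ≠ 0 := by
    rintro rfl
    rw [mul_zero, isCoprime_zero_left] at hpx
    exact hPint.not_isUnit hpx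
  have hxd : 2 * X + 2 * D = 2 * (X + D) := by ring
  rw [hxd] at hcop ⊢
  have hdq : IsCoprime (2 * (X + D)) (q * y ^ 2) := by
    -- qy² + x² - d² = c², and x² - d² is a multiple of x + d, so coprimality to c passes to qy².
    have h1 : IsCoprime (2 * (X + D)) (q * y ^ 2 + 2 * (X + D) * (2 * (X - D))) := by
      have e : q * y ^ 2 + 2 * (X + D) * (2 * (X - D)) = c ^ 2 := by
        linear_combination hcd - hxy
      rw [e]; exact hcop.symm.pow_right
    exact h1.of_add_mul_left_right
  have hdq' : IsCoprime (2 * (X + D)) q := hdq.of_mul_right_left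
  have hsymb := quarticSymbolRatAddI_eq (a := c) hq hdq'
  have hρq : IsCoprime (⟨c, 2 * (X + D)⟩ : GaussianInt) q := by
    refine (isCoprime_of_norm ?_).symm
    have e : (⟨c, 2 * (X + D)⟩ : GaussianInt).norm =
        2 * (2 * X) * (2 * (X + D)) + q * y ^ 2 := by
      rw [norm_eq]; dsimp only; linear_combination hxy - hcd
    rw [e]
    have hxq' := hxq.of_mul_right_left
    exact ((hxq'.of_mul_left_left.mul_left hxq').mul_left hdq').symm.add_mul_left_right (y ^ 2)
  have hQ4 := quarticJacobi_pow_four (odd_norm_intCast.mpr hq) hρq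
  obtain ⟨k₀, hk₀⟩ := exists_eq_iPow hQ4
  have hI0 : ∀ k : ℤ, toComplex (iPow k) = Complex.I ^ k := fun k => by
    rw [map_iPow, toComplex_imUnit]
  refine ⟨hq4, hdq', ⟨k₀, by rw [hsymb, hk₀, hI0]⟩, fun k hk => ?_⟩
  have hk' : quarticJacobi ⟨c, 2 * (X + D)⟩ q = iPow k := by
    apply GaussianInt.toComplex_injective
    rw [← hsymb, hk, hI0]
  obtain ⟨hf, hmain⟩ := x_pow_eq hp hq4 hcd hxy hc hcop hy hX hpx hpy hdq hxq hk'
  have hexp := fun N => exponent_modEq (N := N) hc' hy' hcd hxy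
  have hD4 : D % 2 = 1 → D % 4 = 1 := by
    intro h
    have hd₀' : d₀ % 4 = 1 := hd₀
    -- As d = 2D, r = 0 is impossible, r = 1 gives D = d₀, and r ≥ 2 makes D even.
    rcases r with _ | _ | r
    · omega
    · omega
    · have : 2 * D = 4 * (2 ^ r * d₀) := by rw [hd]; ring
      omega
  generalize hE : (2 * ((y ^ 2 - 1) / 8) + (X + D) -
        (X + D) ^ 2 + if X % 2 = 0 then 0 else 3) = E at hmain hexp
  generalize hfdef : ((2 * D : ℤ) : ZMod p) / (c : ZMod p) = f at hf hmain ⊢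
  have hf0 : f ≠ 0 := by rintro rfl; simp at hf
  have hx0 : ((2 * X : ℤ) : ZMod p) ≠ 0 := by
    rw [Ne, ZMod.intCast_zmod_eq_zero_iff_dvd]
    exact fun h => hPint.not_isUnit (hpx.isUnit_of_dvd' h dvd_rfl)
  have hy0 : (y : ZMod p) ≠ 0 := by
    rw [Ne, ZMod.intCast_zmod_eq_zero_iff_dvd]
    exact fun h => hPint.not_isUnit (hpy.isUnit_of_dvd' h dvd_rfl)
  have hqx : (q : ZMod p) = -(((2 * X : ℤ) : ZMod p) / y) ^ 2 := by
    have h0 : ((2 * X : ℤ) : ZMod p) ^ 2 + q * (y : ZMod p) ^ 2 = 0 := by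
      rw [← ZMod.natCast_self p, ← Int.cast_natCast p, hxy]
      push_cast; ring
    field_simp
    linear_combination h0
  have hxy' : (((2 * X : ℤ) : ZMod p) / y) ^ ((p - 1) / 4) = f ^ (k + E) := by
    rw [div_pow, hmain]; field_simp
  have hqN : ∀ N : ℕ, (q : ZMod p) ^ N =
      f ^ (2 * (N : ℤ)) * (((2 * X : ℤ) : ZMod p) / y) ^ (2 * N) := fun N => by
    rw [hqx, neg_pow, ← pow_mul, ← neg_one_zpow_of_sq_eq_neg_one hf, zpow_natCast]
  refine ⟨fun hp8 => ?_, fun hp8 => ?_⟩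
  · obtain ⟨h1, h5⟩ := (hexp ((p - 1) / 8 : ℕ)).1 (by omega)
    have e : 2 * ((p - 1) / 8) = (p - 1) / 4 := by omega
    rw [hqN, e, hxy', ← zpow_add₀ hf0]
    refine ⟨fun hq8 => ?_, fun hq8 => ?_⟩
    · rw [neg_one_zpow_of_sq_eq_neg_one hf, ← zpow_add₀ hf0]
      apply zpow_congr_of_sq_eq_neg_one hf
      convert (h1 hq8).add_right k using 1
      ring
    · rw [neg_one_zpow_of_sq_eq_neg_one hf, ← zpow_add₀ hf0]
      apply zpow_congr_of_sq_eq_neg_one hf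
      convert (h5 hq8).add_right k using 1 <;> ring
  · obtain ⟨h1, h5⟩ := (hexp ((p - 5) / 8 : ℕ)).2 (by omega) hD4
    -- The exponent 2N falls one short of (p-1)/4; the missing factor x/y is the source of y/x in
    -- the formula.
    have e : 2 * ((p - 5) / 8) + 1 = (p - 1) / 4 := by omega
    have hz : (((2 * X : ℤ) : ZMod p) / y) ^ (2 * ((p - 5) / 8)) =
        f ^ (k + E) * ((y : ZMod p) / ((2 * X : ℤ) : ZMod p)) := by
      rw [← hxy', ← e, pow_succ]; field_simp
    rw [hqN, hz, ← mul_assoc, ← zpow_add₀ hf0]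
    refine ⟨fun hq8 => ?_, fun hq8 => ?_⟩
    · rw [neg_one_zpow_of_sq_eq_neg_one hf, ← zpow_add₀ hf0]
      congr 1
      apply zpow_congr_of_sq_eq_neg_one hf
      convert (h1 hq8).add_right k using 1 <;> ring
    · rw [neg_one_zpow_of_sq_eq_neg_one hf, ← zpow_add₀ hf0]
      congr 1
      apply zpow_congr_of_sq_eq_neg_one hf
      convert (h5 hq8).add_right k using 1
      ring
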